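/- Let $n,p,m\ge 1$, let $x_1,\dots,x_n\in\mathbb R^p$ with $\|x_i\|_2=1$, and let $y_1,\dots,y_n\in\mathbb R$ with $|y_i|<B$. Consider the two-layer ReLU network $$f(W,a,x)=\frac1{\sqrt m}\sum_{r=1}^m a_r\,\sigma(w_r^\top x),\qquad \sigma(z)=\max\{z,0\},\quad W=(w_1,\dots,w_m)\in(\mathbb R^p)^m,\ a\in\mathbb R^m,$$ with the loss $L(W,a)=\frac12\sum_{i=1}^n (f(W,a,x_i)-y_i)^2$. Put $\Delta_i=f(W,a,x_i)-y_i$, let $H(W)\in\mathbb R^{n\times n}$ be the matrix $H_{ij}=\frac1m x_i^\top x_j\sum_{r=1}^m \mathbb 1\{w_r^\top x_i\ge 0,\ w_r^\top x_j\ge 0\}$, and let $\hat L=\frac12\Delta^\top H\Delta$. Let $$H^\infty_{ij}=\mathbb E_{w\sim N(0,I)}\big[x_i^\top x_j\,\mathbb 1\{w^\top x_i\ge0,\ w^\top x_j\ge 0\}\big],\qquad \lambda_0=\lambda_{\min}(H^\infty),$$ and assume $\lambda_0>0$. For every $B$ there is a constant $C>0$, depending only on $B$, such that the following holds for all such data and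 all $\delta\in(0,1)$. Suppose that $m\ge C\,\dfrac{n^6}{\delta^3\lambda_0^4}$ and that all $w_r(0)\sim N(0,I)$ and $a_r\sim\mathrm{unif}\{-1,1\}$, $r=1,\dots,m$, are drawn independently. Then, with probability at least $1-\delta$ over the initialization, every solution $W(t)=(w_r(t))_r$, $t\ge 0$, of the Heavy Ball system ($a$ is kept fixed) $$\ddot w_r(t)+\sqrt{2\lambda_0}\,\dot w_r(t)+\frac{\partial L(W(t),a)}{\partial w_r}=0,\qquad \dot w_r(0)=0,\qquad r=1,\dots,m,$$ with this initial value satisfies, for all $t\ge 0$, $$L(t)\le \frac4{\lambda_0}\,\exp\!\big(-\sqrt{\lambda_0/2}\;t\big)\,\hat L(0),$$ where $L(t)=L(W(t),a)$ and $\hat L(0)$ is the value of $\hat L$ at the initialization $(W(0),a)$. Here $\frac{\partial L}{\partial w_r}=\sum_i (f(W,a,x_i)-y_i)\frac{a_r}{\sqrt m}\,\sigma'(w_r^\top x_i)\,x_i$ and, since this is discontinuous in $W$, a solution means: $W$ is differentiable on $[0,\infty)$, $\dot W$ is absolutely continuous on bounded intervals, and the equation holds for almost every $t\ge0$, where $\sigma'(0)$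 may be any value in $[0,1]$ (possibly depending on $t$, $r$ and $i$). -/

import Mathlib

open MeasureTheory ProbabilityTheory

noncomputable section

namespace HeavyBallNTK

/-- The ReLU activation. -/
def relu (z : ℝ) : ℝ := max z 0

/-- The (convex) subdifferential of the ReLU: `{1}` for `z > 0`, `{0}` for `z < 0`, and `[0, 1]`
at the kink `z = 0`. It contains both `𝟙(z ≥ 0)` and `𝟙(z > 0)`. -/
def reluSubdiff (z : ℝ) : Set ℝ :=
  {s | 0 ≤ s ∧ s ≤ 1 ∧ (0 < z → s = 1) ∧ (z < 0 → s = 0)}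

/-- The two-layer network `f(W, a, x) = m^{-1/2} ∑ᵣ aᵣ σ(wᵣᵀ x)`. -/
def network {m p : ℕ} (W : Fin m → EuclideanSpace ℝ (Fin p)) (a : Fin m → ℝ)
    (x : EuclideanSpace ℝ (Fin p)) : ℝ :=
  1 / Real.sqrt m * ∑ r, a r * relu (inner ℝ (W r) x)

/-- The prediction error `Δ = f - y ∈ ℝⁿ` on the training set `(xᵢ, yᵢ)`. -/
def predError {m n p : ℕ} (x : Fin n → EuclideanSpace ℝ (Fin p)) (y : Fin n → ℝ)
    (W : Fin m → EuclideanSpace ℝ (Fin p)) (a : Fin m → ℝ) : Fin n → ℝ :=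
  fun i => network W a (x i) - y i

/-- The loss `L = 1/2 ∑ᵢ (f(W, a, xᵢ) - yᵢ)²`. -/
def loss {m n p : ℕ} (x : Fin n → EuclideanSpace ℝ (Fin p)) (y : Fin n → ℝ)
    (W : Fin m → EuclideanSpace ℝ (Fin p)) (a : Fin m → ℝ) : ℝ :=
  1 / 2 * ∑ i, (network W a (x i) - y i) ^ 2

open Classical in
/-- The finite-width kernel `H_{ij} = m⁻¹ xᵢᵀxⱼ ∑ᵣ 𝟙(wᵣᵀxᵢ ≥ 0, wᵣᵀxⱼ ≥ 0)`. -/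
def ntkMatrix {m n p : ℕ} (x : Fin n → EuclideanSpace ℝ (Fin p))
    (W : Fin m → EuclideanSpace ℝ (Fin p)) : Matrix (Fin n) (Fin n) ℝ :=
  Matrix.of fun i j => 1 / (m : ℝ) * inner ℝ (x i) (x j) *
    ∑ r, if 0 ≤ inner ℝ (W r) (x i) ∧ 0 ≤ inner ℝ (W r) (x j) then (1 : ℝ) else 0

/-- The pseudo-loss `L̂ = 1/2 Δᵀ H Δ`. -/
def pseudoLoss {m n p : ℕ} (x : Fin n → EuclideanSpace ℝ (Fin p)) (y : Fin n → ℝ)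
    (W : Fin m → EuclideanSpace ℝ (Fin p)) (a : Fin m → ℝ) : ℝ :=
  1 / 2 * (predError x y W a ⬝ᵥ (ntkMatrix x W).mulVec (predError x y W a))

open Classical in
/-- The limiting kernel `H^∞_{ij} = 𝔼_{w ∼ N(0, I)} [xᵢᵀxⱼ 𝟙(wᵀxᵢ ≥ 0, wᵀxⱼ ≥ 0)]`. -/
def limitNTK {n p : ℕ} (x : Fin n → EuclideanSpace ℝ (Fin p)) : Matrix (Fin n) (Fin n) ℝ :=
  Matrix.of fun i j => ∫ w, inner ℝ (x i) (x j) *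
    (if 0 ≤ inner ℝ w (x i) ∧ 0 ≤ inner ℝ w (x j) then (1 : ℝ) else 0)
      ∂(stdGaussian (EuclideanSpace ℝ (Fin p)))

/-- The smallest (real) eigenvalue of a square matrix. For a symmetric matrix of positive size the
set of eigenvalues is finite and non-empty, so the infimum is a minimum. -/
def lambdaMin {n : ℕ} (A : Matrix (Fin n) (Fin n) ℝ) : ℝ :=
  sInf {μ : ℝ | Module.End.HasEigenvalue (Matrix.toLin' A) μ}

/-- The uniform distribution on `{-1, 1}`. -/
def signMeasure : Measure ℝ :=
  (2⁻¹ : ENNReal) • Measure.dirac (-1) + (2⁻¹ : ENNReal) • Measure.dirac 1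

/-- The law of the initialization `(W, a)`: all `wᵣ ∼ N(0, I)` and `aᵣ ∼ unif{-1, 1}` are
independent. -/
def initLaw (m p : ℕ) : Measure ((Fin m → EuclideanSpace ℝ (Fin p)) × (Fin m → ℝ)) :=
  (Measure.pi fun _ : Fin m => stdGaussian (EuclideanSpace ℝ (Fin p))).prod
    (Measure.pi fun _ : Fin m => signMeasure)

/-- `∂L/∂wᵣ = ∑ᵢ (fᵢ - yᵢ) m^{-1/2} aᵣ s_{ri} xᵢ`, where `s_{ri}` is the value used for
`σ'(wᵣᵀxᵢ)`. -/
def lossGrad {m n p : ℕ} (x : Fin n → EuclideanSpace ℝ (Fin p)) (y : Fin n → ℝ)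
    (W : Fin m → EuclideanSpace ℝ (Fin p)) (a : Fin m → ℝ) (s : Fin m → Fin n → ℝ)
    (r : Fin m) : EuclideanSpace ℝ (Fin p) :=
  ∑ i, (predError x y W a i * (1 / Real.sqrt m * a r * s r i)) • x i

/-- Where the loss is differentiable in `wᵣ` because no `wᵣᵀxᵢ` vanishes, `lossGrad` is its
gradient in `wᵣ`. -/
theorem hasGradientAt_loss {m n p : ℕ} (x : Fin n → EuclideanSpace ℝ (Fin p)) (y : Fin n → ℝ)
    (W : Fin m → EuclideanSpace ℝ (Fin p)) (a : Fin m → ℝ) (s : Fin m → Fin n → ℝ) (r : Fin m)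
    (hW : ∀ i, inner ℝ (W r) (x i) ≠ 0)
    (hs : ∀ i, s r i ∈ reluSubdiff (inner ℝ (W r) (x i))) :
    HasGradientAt (fun u => loss x y (Function.update W r u) a) (lossGrad x y W a s r) (W r) := by
  have hrelu : ∀ i, HasDerivAt relu (s r i) (inner ℝ (W r) (x i)) := by
    intro i
    obtain ⟨-, -, h1, h0⟩ := hs i
    rcases lt_or_gt_of_ne (hW i) with h | h
    · rw [h0 h]
      refine (hasDerivAt_const _ (0 : ℝ)).congr_of_eventuallyEq ?_
      filter_upwards [eventually_lt_nhds h] with z hz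
      exact max_eq_right hz.le
    · rw [h1 h]
      refine (hasDerivAt_id _).congr_of_eventuallyEq ?_
      filter_upwards [eventually_gt_nhds h] with z hz
      exact max_eq_left hz.le
  have hnet : ∀ i, HasGradientAt (fun u => network (Function.update W r u) a (x i))
      ((1 / Real.sqrt m * a r * s r i) • x i) (W r) := by
    intro i
    have hin : HasFDerivAt (fun u : EuclideanSpace ℝ (Fin p) => inner ℝ u (x i))
        (innerSL ℝ (x i)) (W r) :=
      (innerSL ℝ (x i)).hasFDerivAt.congr_of_eventuallyEq
        (Filter.Eventually.of_forall fun u => by simp [real_inner_comm])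
    have h : HasFDerivAt (fun u : EuclideanSpace ℝ (Fin p) => relu (inner ℝ u (x i)))
        (s r i • innerSL ℝ (x i)) (W r) :=
      HasDerivAt.comp_hasFDerivAt (h₂ := relu) (W r) (hrelu i) hin
    have h2 := ((h.const_mul (a r)).add_const
      (∑ q ∈ Finset.univ.erase r, a q * relu (inner ℝ (W q) (x i)))).const_mul (1 / Real.sqrt m)
    rw [hasGradientAt_iff_hasFDerivAt]
    refine (h2.congr_fderiv ?_).congr_of_eventuallyEq (Filter.Eventually.of_forall fun u => ?_)
    · ext v
      simp [mul_assoc]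
    · change network (Function.update W r u) a (x i) = _
      rw [network, ← Finset.add_sum_erase _ _ (Finset.mem_univ r), Function.update_self]
      congr 2
      refine Finset.sum_congr rfl fun q hq => ?_
      rw [Function.update_of_ne (Finset.ne_of_mem_erase hq)]
  have hL := (HasFDerivAt.fun_sum (u := Finset.univ) fun i _ =>
    (((hnet i).hasFDerivAt.sub_const (y i)).pow 2)).const_mul (1 / 2 : ℝ)
  rw [hasGradientAt_iff_hasFDerivAt]
  refine hL.congr_fderiv ?_
  ext v
  simp [lossGrad, predError, Finset.mul_sum, mul_assoc]

/-- `W : [0, ∞) → ℝ^{m × p}` solves the Heavy Ball system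
`ẅᵣ + b ẇᵣ + ∂L(W, a)/∂wᵣ = 0`, `ẇᵣ(0) = 0`, for `r = 1, …, m`.
The right-hand side jumps where some `wᵣᵀxᵢ` changes sign, so the equation is understood in the
usual sense for such systems: `W` is differentiable with a locally absolutely continuous
derivative `V`, and the second order equation holds for almost every time, the derivative of the
ReLU at its kink being any of its subgradients. -/
def IsHeavyBallFlow {m n p : ℕ} (b : ℝ) (x : Fin n → EuclideanSpace ℝ (Fin p)) (y : Fin n → ℝ)
    (a : Fin m → ℝ) (W : ℝ → Fin m → EuclideanSpace ℝ (Fin p)) : Prop :=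
  ∃ V : ℝ → Fin m → EuclideanSpace ℝ (Fin p),
    (∀ t, 0 ≤ t → ∀ r, HasDerivWithinAt (fun τ => W τ r) (V t r) (Set.Ici 0) t) ∧
    (∀ r, V 0 r = 0) ∧
    (∀ T, 0 ≤ T → ∀ r, AbsolutelyContinuousOnInterval (fun τ => V τ r) 0 T) ∧
    ∀ᵐ t ∂(volume.restrict (Set.Ici (0 : ℝ))), ∃ s : Fin m → Fin n → ℝ,
      (∀ r i, s r i ∈ reluSubdiff (inner ℝ (W t r) (x i))) ∧
      ∀ r, ∃ A : EuclideanSpace ℝ (Fin p), HasDerivAt (fun τ => V τ r) A t ∧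
        A + b • V t r + lossGrad x y (W t) a s r = 0

end HeavyBallNTK

end

/-! Put ρ = √(λ₀/2), so that the friction is 2ρ. Along a solution the error D = f − y and the
velocity V satisfy, for almost every time, D' = J V and V' = −2ρ V − J†D, where J is the Jacobian of
the outputs for the ReLU subgradients in use. Since J may jump, D is never differentiated twice.
Instead J is compared with the fixed Jacobian A of the initial activation pattern, for which A A† =
H(W(0)).

If A A† ≥ (9/5)ρ² and ‖J − A‖ ≤ ρ/6, then Φ = ½‖D‖² + ½‖V‖² + ρ⟨M D, V⟩ with M = A†(A A†)⁻¹ obeys Φ'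
≤ −ρ Φ (`norm_sq_le_exp_of_heavyBall`). Friction alone dissipates only V; the cross term adds
−ρ‖D‖², because A M = 1, and costs at most ρ‖V‖², because M A is a projection, both up to errors of
size ‖J − A‖. The energy terms ⟨D, J V⟩ cancel only if the same subgradients drive both equations;
`hasDerivAt_relu_comp` shows that the chain rule allows any of them at almost every time.

Closeness of J to A is a bootstrap (`norm_sq_errorVec_le_of_isHeavyBallFlow`). While no weight has
moved by more than R, only pairs with |wᵣ(0)ᵀxᵢ| ≤ R can change activation, and these are few. The
error then decays exponentially, so each neuron feels a force of order √(n/m)‖D(0)‖e^{−ρt/2} and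
moves by less than R in total.

The initial conditions hold with probability 1 − δ by Markov's inequality for the squared error, the
squared Frobenius distance of H from its limit, and the fraction of pairs near a kink
(`le_initLaw_goodInit`). -/

namespace HeavyBallNTK

/-! ### Calculus of absolutely continuous functions and a Grönwall inequality -/

section AbsolutelyContinuous

open Set Filter

theorem _root_.LipschitzWith.comp_absolutelyContinuousOnInterval {X Y : Type*}
    [PseudoMetricSpace X] [PseudoMetricSpace Y] {K : NNReal} {φ : X → Y} (hφ : LipschitzWith K φ)
    {f : ℝ → X} {a b : ℝ} (hf : AbsolutelyContinuousOnInterval f a b) :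
    AbsolutelyContinuousOnInterval (fun t => φ (f t)) a b := by
  apply squeeze_zero (fun t ↦ ?_) (fun t ↦ ?_) (by simpa using Tendsto.const_mul (K : ℝ) hf)
  · exact Finset.sum_nonneg (fun i hi ↦ by positivity)
  · rw [Finset.mul_sum]
    exact Finset.sum_le_sum fun i _ => hφ.dist_le_mul _ _

theorem absolutelyContinuousOnInterval_const {X : Type*} [PseudoMetricSpace X] (c : X) (a b : ℝ) :
    AbsolutelyContinuousOnInterval (fun _ : ℝ => c) a b :=
  ((LipschitzWith.const c).lipschitzOnWith (s := uIcc a b)).absolutelyContinuousOnInterval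

theorem _root_.AbsolutelyContinuousOnInterval.finset_sum {F ι : Type*} [SeminormedAddCommGroup F]
    {f : ι → ℝ → F} {a b : ℝ} (s : Finset ι)
    (hf : ∀ i ∈ s, AbsolutelyContinuousOnInterval (f i) a b) :
    AbsolutelyContinuousOnInterval (fun t => ∑ i ∈ s, f i t) a b := by
  classical
  induction s using Finset.induction_on with
  | empty => simpa using absolutelyContinuousOnInterval_const (0 : F) a b
  | insert i s hi ih =>
    simp only [Finset.sum_insert hi]
    exact (hf i (by simp)).fun_add (ih fun j hj => hf j (by simp [hj]))

variable {U : Type*} [NormedAddCommGroup U] [InnerProductSpace ℝ U] [FiniteDimensional ℝ U]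

/-- Expansion in an orthonormal basis reduces this to finitely many products of scalar functions;
finite dimension enters here. -/
theorem _root_.AbsolutelyContinuousOnInterval.real_inner {f g : ℝ → U} {a b : ℝ}
    (hf : AbsolutelyContinuousOnInterval f a b) (hg : AbsolutelyContinuousOnInterval g a b) :
    AbsolutelyContinuousOnInterval (fun t => inner ℝ (f t) (g t)) a b := by
  have key : ∀ t, inner ℝ (f t) (g t) = ∑ i, inner ℝ (stdOrthonormalBasis ℝ U i) (f t) *
      inner ℝ (stdOrthonormalBasis ℝ U i) (g t) := by
    intro t
    rw [← (stdOrthonormalBasis ℝ U).sum_inner_mul_inner (f t) (g t)]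
    exact Finset.sum_congr rfl fun i _ => by rw [real_inner_comm]
  simp only [key]
  refine AbsolutelyContinuousOnInterval.finset_sum _ fun i _ => ?_
  exact ((innerSL ℝ (stdOrthonormalBasis ℝ U i)).lipschitz.comp_absolutelyContinuousOnInterval
    hf).fun_mul
    ((innerSL ℝ (stdOrthonormalBasis ℝ U i)).lipschitz.comp_absolutelyContinuousOnInterval hg)

/-- An absolutely continuous function whose derivative is a.e. nonpositive does not increase. -/
theorem _root_.AbsolutelyContinuousOnInterval.le_left_of_ae_deriv_nonpos {g : ℝ → ℝ} {T t : ℝ}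
    (hg : AbsolutelyContinuousOnInterval g 0 T) (ht : t ∈ Icc 0 T)
    (h : ∀ᵐ s, s ∈ Ioo 0 T → ∃ d ≤ 0, HasDerivAt g d s) : g t ≤ g 0 := by
  have hT : 0 ≤ T := ht.1.trans ht.2
  have hg' : AbsolutelyContinuousOnInterval g 0 t := hg.mono (by
    rw [uIcc_of_le ht.1, uIcc_of_le hT]; exact Icc_subset_Icc_right ht.2)
  have h1 := hg'.integral_deriv_eq_sub
  have h2 : ∫ s in (0 : ℝ)..t, deriv g s ≤ 0 := by
    rw [intervalIntegral.integral_of_le ht.1, integral_Ioc_eq_integral_Ioo]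
    refine setIntegral_nonpos_ae measurableSet_Ioo ?_
    filter_upwards [h] with s hs hst
    obtain ⟨d, hd, hd'⟩ := hs ⟨hst.1, hst.2.trans_le ht.2⟩
    rwa [hd'.deriv]
  linarith

/-- The linear differential inequality `Φ' ≤ -ρ Φ` for absolutely continuous functions. -/
theorem _root_.AbsolutelyContinuousOnInterval.le_exp_mul_of_ae_deriv_le {Φ : ℝ → ℝ} {T t ρ : ℝ}
    (hΦ : AbsolutelyContinuousOnInterval Φ 0 T) (ht : t ∈ Icc 0 T)
    (h : ∀ᵐ s, s ∈ Ioo 0 T → ∃ d ≤ -(ρ * Φ s), HasDerivAt Φ d s) :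
    Φ t ≤ Real.exp (-(ρ * t)) * Φ 0 := by
  have hexp : AbsolutelyContinuousOnInterval (fun s => Real.exp (ρ * s)) 0 T :=
    (ContDiffOn.absolutelyContinuousOnInterval (by fun_prop))
  -- Integrating factor: e^{ρs} Φ(s) has nonpositive derivative almost everywhere.
  have key := (hexp.fun_mul hΦ).le_left_of_ae_deriv_nonpos ht (by
    filter_upwards [h] with s hs hst
    obtain ⟨d, hd, hd'⟩ := hs hst
    refine ⟨_, ?_, (((hasDerivAt_id s).const_mul ρ).exp).mul hd'⟩
    have := Real.exp_pos (ρ * s)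
    simp only [id, mul_one]
    nlinarith)
  simp only [mul_zero, Real.exp_zero, one_mul] at key
  rw [Real.exp_neg, inv_mul_eq_div, le_div_iff₀ (Real.exp_pos _), mul_comm]
  exact key

end AbsolutelyContinuous

/-! ### Lyapunov function for the coupled error and velocity system -/

section Lyapunov

open Set ContinuousLinearMap

variable {U F : Type*} [NormedAddCommGroup U] [InnerProductSpace ℝ U] [FiniteDimensional ℝ U]
  [NormedAddCommGroup F] [InnerProductSpace ℝ F] [CompleteSpace U] [CompleteSpace F]

/-- A map `A` with `A A† ≥ c` has the right inverse `M = A† (A A†)⁻¹`; it satisfies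
`‖M‖² ≤ 1 / c`, and `M A` is the orthogonal projection onto the range of `A†`. -/
theorem exists_rightInverse (A : F →L[ℝ] U) {c : ℝ}
    (hc : 0 < c) (hA : ∀ z, c * ‖z‖ ^ 2 ≤ ‖adjoint A z‖ ^ 2) :
    ∃ M : U →L[ℝ] F, (∀ z, A (M z) = z) ∧ (∀ z, c * ‖M z‖ ^ 2 ≤ ‖z‖ ^ 2) ∧
      ∀ v, inner ℝ (M (A v)) v ≤ ‖v‖ ^ 2 := by
  set S : U →ₗ[ℝ] U := (A ∘L adjoint A).toLinearMap with hS
  have hSz : ∀ z, S z = A (adjoint A z) := fun z => rfl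
  have hinner : ∀ z, inner ℝ (S z) z = ‖adjoint A z‖ ^ 2 := by
    intro z
    rw [hSz, ← adjoint_inner_right, real_inner_self_eq_norm_sq]
  have hinj : Function.Injective S := by
    rw [injective_iff_map_eq_zero]
    intro z hz
    have h1 := hA z
    rw [← hinner, hz, inner_zero_left] at h1
    have : ‖z‖ ^ 2 ≤ 0 := by nlinarith [sq_nonneg ‖z‖]
    simpa using le_antisymm this (sq_nonneg _)
  set N := (LinearEquiv.ofInjectiveEndo S hinj).symm with hN
  have hSN : ∀ z, S (N z) = z := fun z =>
    (LinearEquiv.ofInjectiveEndo S hinj).apply_symm_apply z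
  refine ⟨adjoint A ∘L (LinearMap.toContinuousLinearMap (N : U →ₗ[ℝ] U)), ?_, ?_, ?_⟩
  · intro z
    exact hSN z
  · intro z
    change c * ‖adjoint A (N z)‖ ^ 2 ≤ _
    have h1 : ‖adjoint A (N z)‖ ^ 2 ≤ ‖z‖ * ‖N z‖ := by
      rw [← hinner, hSN]; exact real_inner_le_norm _ _
    have h2 := hA (N z)
    have h3 : c * ‖N z‖ ≤ ‖z‖ := by
      rcases (norm_nonneg (N z)).eq_or_lt with h | h
      · rw [← h]; simp
      · refine le_of_mul_le_mul_right ?_ h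
        nlinarith
    nlinarith [norm_nonneg z]
  · intro v
    change inner ℝ (adjoint A (N (A v))) v ≤ _
    have h1 : inner ℝ (adjoint A (N (A v))) v = ‖adjoint A (N (A v))‖ ^ 2 := by
      rw [adjoint_inner_left, ← hinner, hSN, real_inner_comm]
    have h2 := real_inner_le_norm (adjoint A (N (A v))) v
    rw [h1] at h2 ⊢
    nlinarith [norm_nonneg v, norm_nonneg (adjoint A (N (A v)))]

/-- The heavy ball system `Δ' = J V`, `V' = -2ρ V - J† Δ` whose Jacobian `J` stays close to a fixed
surjective map `A` contracts `‖Δ‖²` at the rate `ρ`. -/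
theorem norm_sq_le_exp_of_heavyBall [FiniteDimensional ℝ F] {ρ T : ℝ} (hρ : 0 < ρ)
    (A : F →L[ℝ] U) (hA : ∀ z, 9 / 5 * ρ ^ 2 * ‖z‖ ^ 2 ≤ ‖adjoint A z‖ ^ 2)
    {D : ℝ → U} {V : ℝ → F} (hD : AbsolutelyContinuousOnInterval D 0 T)
    (hV : AbsolutelyContinuousOnInterval V 0 T) (hV0 : V 0 = 0)
    (h : ∀ᵐ t, t ∈ Ioo 0 T → ∃ J : F →L[ℝ] U, ‖J - A‖ ≤ ρ / 6 ∧ HasDerivAt D (J (V t)) t ∧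
      HasDerivAt V (-((2 * ρ) • V t) - adjoint J (D t)) t)
    {t : ℝ} (ht : t ∈ Icc 0 T) :
    ‖D t‖ ^ 2 ≤ 16 / 7 * Real.exp (-(ρ * t)) * ‖D 0‖ ^ 2 := by
  obtain ⟨M, hAM, hM, hMA⟩ := exists_rightInverse A (by positivity) hA
  -- The bound on M gives ρ²‖M z‖² ≤ (5/9)‖z‖², and 5/9 < 9/16.
  have hMn : ∀ z, ρ * ‖M z‖ ≤ 3 / 4 * ‖z‖ := by
    intro z
    refine le_of_sq_le_sq ?_ (by positivity)
    nlinarith [hM z, sq_nonneg ‖z‖]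
  set Φ : ℝ → ℝ := fun s => 1 / 2 * inner ℝ (D s) (D s) + 1 / 2 * inner ℝ (V s) (V s) +
    ρ * inner ℝ (M (D s)) (V s) with hΦdef
  have hMD := M.lipschitz.comp_absolutelyContinuousOnInterval hD
  have hΦ : AbsolutelyContinuousOnInterval Φ 0 T :=
    (((hD.real_inner hD).const_mul _).fun_add ((hV.real_inner hV).const_mul _)).fun_add
      ((hMD.real_inner hV).const_mul _)
  have hcross : ∀ s, |ρ * inner ℝ (M (D s)) (V s)| ≤ 3 / 4 * (‖D s‖ * ‖V s‖) := by
    intro s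
    rw [abs_mul, abs_of_pos hρ]
    calc ρ * |inner ℝ (M (D s)) (V s)| ≤ ρ * (‖M (D s)‖ * ‖V s‖) := by
          gcongr; exact abs_real_inner_le_norm _ _
      _ = (ρ * ‖M (D s)‖) * ‖V s‖ := by ring
      _ ≤ (3 / 4 * ‖D s‖) * ‖V s‖ := mul_le_mul_of_nonneg_right (hMn _) (norm_nonneg _)
      _ = _ := by ring
  have hdecay := hΦ.le_exp_mul_of_ae_deriv_le (ρ := ρ) ht (by
    filter_upwards [h] with s hs hsT
    obtain ⟨J, hJ, hD', hV'⟩ := hs hsT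
    have hM' : HasDerivAt (fun s => M (D s)) (M (J (V s))) s := M.hasFDerivAt.comp_hasDerivAt s hD'
    refine ⟨_, ?_, (((hD'.inner ℝ hD').const_mul (1 / 2)).add
      ((hV'.inner ℝ hV').const_mul (1 / 2))).add ((hM'.inner ℝ hV').const_mul ρ)⟩
    set E := J - A with hE
    have hJE : J = A + E := by simp [hE]
    have e1 : inner ℝ (M (E (V s))) (V s) ≤ 1 / 8 * ‖V s‖ ^ 2 := by
      have h1 := real_inner_le_norm (M (E (V s))) (V s)
      have h2 := hMn (E (V s))
      have h3 : ‖E (V s)‖ ≤ ρ / 6 * ‖V s‖ := E.le_of_opNorm_le hJ _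
      have h4 : ‖M (E (V s))‖ ≤ 1 / 8 * ‖V s‖ := by
        refine le_of_mul_le_mul_left ?_ hρ
        nlinarith
      nlinarith [norm_nonneg (V s)]
    have e2 : -inner ℝ (E (M (D s))) (D s) ≤ 1 / 8 * ‖D s‖ ^ 2 := by
      have h1 := neg_le_of_abs_le (abs_real_inner_le_norm (E (M (D s))) (D s))
      have h2 := hMn (D s)
      have h3 : ‖E (M (D s))‖ ≤ ρ / 6 * ‖M (D s)‖ := E.le_of_opNorm_le hJ _
      have h4 : ‖E (M (D s))‖ ≤ 1 / 8 * ‖D s‖ := by nlinarith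
      nlinarith [norm_nonneg (D s)]
    have c1 : inner ℝ (J (V s)) (D s) = inner ℝ (adjoint J (D s)) (V s) := by
      rw [adjoint_inner_left, real_inner_comm]
    have c2 : inner ℝ (M (D s)) (adjoint J (D s)) =
        ‖D s‖ ^ 2 + inner ℝ (E (M (D s))) (D s) := by
      rw [adjoint_inner_right, hJE, add_apply, inner_add_left, hAM, real_inner_self_eq_norm_sq]
    have c3 : inner ℝ (M (J (V s))) (V s) =
        inner ℝ (M (A (V s))) (V s) + inner ℝ (M (E (V s))) (V s) := by
      rw [hJE, add_apply, map_add, inner_add_left]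
    have c4 := hMA (V s)
    have c5 := abs_le.mp (hcross s)
    simp only [hΦdef, inner_sub_left, inner_sub_right, inner_neg_left, inner_neg_right,
      real_inner_smul_left, real_inner_smul_right, c3, c2, real_inner_self_eq_norm_sq,
      real_inner_comm (J (V s)) (D s), real_inner_comm (adjoint J (D s)) (V s), c1]
    have q : ‖D s‖ * ‖V s‖ ≤ 1 / 2 * (‖D s‖ ^ 2 + ‖V s‖ ^ 2) := by
      nlinarith [sq_nonneg (‖D s‖ - ‖V s‖)]
    -- This is Φ' ≤ −ρΦ after division by ρ. The budget is used up exactly: 1 + 1/8 + 3/8 = 3/2 for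
    -- ‖V‖² and 1/8 + 3/8 = 1/2 for ‖D‖².
    have fin : inner ℝ (M (A (V s))) (V s) + inner ℝ (M (E (V s))) (V s) -
        inner ℝ (E (M (D s))) (D s) - ρ * inner ℝ (M (D s)) (V s) ≤
        1 / 2 * ‖D s‖ ^ 2 + 3 / 2 * ‖V s‖ ^ 2 := by linarith [c5.1]
    nlinarith [mul_le_mul_of_nonneg_left fin hρ.le])
  have h0 : Φ 0 = 1 / 2 * ‖D 0‖ ^ 2 := by simp [hΦdef, hV0]
  -- Completing the square in ‖V‖ leaves 1/2 − 9/32 = 7/32; with Φ(0) = ½‖D(0)‖² this produces the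
  -- factor 16/7.
  have hlow : 7 / 32 * ‖D t‖ ^ 2 ≤ Φ t := by
    have := (abs_le.mp (hcross t)).1
    simp only [hΦdef, real_inner_self_eq_norm_sq]
    nlinarith [sq_nonneg (‖V t‖ - 3 / 4 * ‖D t‖)]
  rw [h0] at hdecay
  nlinarith

end Lyapunov

open Set

/-! ### Chain rule for the ReLU at its kink -/

section Relu

theorem lipschitzWith_relu : LipschitzWith 1 relu := by
  refine LipschitzWith.of_dist_le_mul fun a b => ?_
  simpa [relu, Real.dist_eq] using abs_max_sub_max_le_abs a b 0

theorem relu_nonneg (z : ℝ) : 0 ≤ relu z := le_max_right _ _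

theorem relu_neg (z : ℝ) : relu (-z) = relu z - z := by
  rcases le_total 0 z with h | h <;> simp [relu, h]

/-- The chain rule for `relu ∘ g` holds with every subgradient wherever `relu ∘ g` is
differentiable. -/
theorem hasDerivAt_relu_comp {g : ℝ → ℝ} {g' t s : ℝ} (hg : HasDerivAt g g' t)
    (hd : DifferentiableAt ℝ (fun τ => relu (g τ)) t) (hs : s ∈ reluSubdiff (g t)) :
    HasDerivAt (fun τ => relu (g τ)) (s * g') t := by
  obtain ⟨-, -, h1, h0⟩ := hs
  rcases lt_trichotomy (g t) 0 with h | h | h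
  · rw [h0 h, zero_mul]
    refine (hasDerivAt_const _ (0 : ℝ)).congr_of_eventuallyEq ?_
    filter_upwards [hg.continuousAt.eventually_lt_const h] with z hz
    exact max_eq_right hz.le
  -- At a zero of g both relu ∘ g and relu ∘ (−g) are minimal, so both derivatives vanish. Their
  -- difference is g, hence g' = 0 and the value of s is irrelevant.
  · have hmin : ∀ f : ℝ → ℝ, f t = 0 → IsLocalMin (fun τ => relu (f τ)) t := fun f hf =>
      Filter.Eventually.of_forall fun τ => by
        simp [hf, relu]
    have e1 : HasDerivAt (fun τ => relu (g τ)) 0 t := by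
      have := hd.hasDerivAt
      rwa [(hmin g h).deriv_eq_zero] at this
    have e2 : HasDerivAt (fun τ => relu (-g τ)) (0 - g') t := by
      simp only [relu_neg]
      exact e1.sub hg
    have e3 := (hmin (fun τ => -g τ) (by simp [h])).hasDerivAt_eq_zero e2
    have : g' = 0 := by linarith
    rw [this, mul_zero]
    exact e1
  · rw [h1 h, one_mul]
    refine hg.congr_of_eventuallyEq ?_
    filter_upwards [hg.continuousAt.eventually_const_lt h] with z hz
    exact max_eq_left hz.le

end Relu

/-! ### From a decaying force to a bounded displacement -/

section Displacement

variable {E : Type*} [NormedAddCommGroup E] [InnerProductSpace ℝ E] [FiniteDimensional ℝ E]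

/-- A damped velocity driven by an exponentially decaying force decays exponentially. -/
theorem norm_velocity_le {ρ K T : ℝ} (hρ : 0 < ρ) (hK : 0 ≤ K) {v : ℝ → E}
    (hv : AbsolutelyContinuousOnInterval v 0 T) (hv0 : v 0 = 0)
    (h : ∀ᵐ s, s ∈ Ioo 0 T → ∃ q : E, ‖q‖ ≤ K * Real.exp (-(ρ / 2 * s)) ∧
      HasDerivAt v (-((2 * ρ) • v s) - q) s) {t : ℝ} (ht : t ∈ Icc 0 T) :
    ‖v t‖ ≤ 2 * K / (3 * ρ) * Real.exp (-(ρ / 2 * t)) := by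
  -- Testing against the fixed vector v(t) makes the problem scalar and avoids differentiating ‖v‖
  -- where v vanishes.
  set e := v t with he
  have hac : AbsolutelyContinuousOnInterval (fun s => Real.exp (2 * ρ * s) * inner ℝ (v s) e -
      ‖e‖ * (2 * K / (3 * ρ)) * Real.exp (3 / 2 * ρ * s)) 0 T := by
    -- The factor e^{2ρs} removes the friction; the force then grows at most like e^{(2ρ − ρ/2)s},
    -- which the subtracted term integrates.
    refine AbsolutelyContinuousOnInterval.fun_sub (AbsolutelyContinuousOnInterval.fun_mul ?_
      (hv.real_inner (absolutelyContinuousOnInterval_const e 0 T))) ?_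
    · exact ContDiffOn.absolutelyContinuousOnInterval (by fun_prop)
    · exact ContDiffOn.absolutelyContinuousOnInterval (by fun_prop)
  have key := hac.le_left_of_ae_deriv_nonpos ht (by
    filter_upwards [h] with s hs hsT
    obtain ⟨q, hq, hd⟩ := hs hsT
    refine ⟨_, ?_, ((((hasDerivAt_id s).const_mul (2 * ρ)).exp).mul
      (hd.inner ℝ (hasDerivAt_const s e))).sub
      ((((hasDerivAt_id s).const_mul (3 / 2 * ρ)).exp).const_mul (‖e‖ * (2 * K / (3 * ρ))))⟩
    simp only [id, mul_one, inner_zero_right, inner_sub_left, inner_neg_left,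
      real_inner_smul_left, zero_add]
    have h1 : -inner ℝ q e ≤ K * Real.exp (-(ρ / 2 * s)) * ‖e‖ :=
      (neg_le_of_abs_le (abs_real_inner_le_norm q e) |> fun h => by linarith :
        -inner ℝ q e ≤ ‖q‖ * ‖e‖).trans (mul_le_mul_of_nonneg_right hq (norm_nonneg _))
    have h2 : Real.exp (3 / 2 * ρ * s) = Real.exp (2 * ρ * s) * Real.exp (-(ρ / 2 * s)) := by
      rw [← Real.exp_add]; ring_nf
    have h3 : ‖e‖ * (2 * K / (3 * ρ)) * (Real.exp (3 / 2 * ρ * s) * (3 / 2 * ρ)) =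
        Real.exp (2 * ρ * s) * (K * Real.exp (-(ρ / 2 * s)) * ‖e‖) := by
      rw [h2]; field_simp
    rw [h3]
    nlinarith [mul_le_mul_of_nonneg_left h1 (Real.exp_pos (2 * ρ * s)).le])
  simp only [hv0, inner_zero_left, mul_zero, Real.exp_zero, mul_one, zero_sub, ← he,
    real_inner_self_eq_norm_sq] at key
  have h4 : 0 ≤ ‖e‖ * (2 * K / (3 * ρ)) := by positivity
  have h2 : Real.exp (3 / 2 * ρ * t) = Real.exp (2 * ρ * t) * Real.exp (-(ρ / 2 * t)) := by
    rw [← Real.exp_add]; ring_nf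
  rw [h2] at key
  have h5 : ‖e‖ * ‖e‖ ≤ ‖e‖ * (2 * K / (3 * ρ) * Real.exp (-(ρ / 2 * t))) := by
    refine le_of_mul_le_mul_left ?_ (Real.exp_pos (2 * ρ * t))
    nlinarith
  rcases (norm_nonneg e).eq_or_lt with h | h
  · rw [← h]; positivity
  · exact le_of_mul_le_mul_left h5 h

/-- A path whose velocity decays exponentially stays close to its starting point. -/
theorem norm_displacement_le {ρ c T : ℝ} (hρ : 0 < ρ) (hc : 0 ≤ c) {w v : ℝ → E}
    (hw : AbsolutelyContinuousOnInterval w 0 T)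
    (h : ∀ s ∈ Ioo 0 T, HasDerivAt w (v s) s ∧ ‖v s‖ ≤ c * Real.exp (-(ρ / 2 * s)))
    {t : ℝ} (ht : t ∈ Icc 0 T) : ‖w t - w 0‖ ≤ 2 * c / ρ := by
  set e := w t - w 0 with he
  have hac : AbsolutelyContinuousOnInterval (fun s => inner ℝ (w s - w 0) e +
      ‖e‖ * (2 * c / ρ) * Real.exp (-(ρ / 2) * s)) 0 T := by
    refine AbsolutelyContinuousOnInterval.fun_add
      ((hw.fun_sub (absolutelyContinuousOnInterval_const (w 0) 0 T)).real_inner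
        (absolutelyContinuousOnInterval_const e 0 T)) ?_
    exact ContDiffOn.absolutelyContinuousOnInterval (by fun_prop)
  have key := hac.le_left_of_ae_deriv_nonpos ht (by
    filter_upwards with s hsT
    obtain ⟨hd, hv⟩ := h s hsT
    refine ⟨_, ?_, ((hd.sub_const (w 0)).inner ℝ (hasDerivAt_const s e)).add
      ((((hasDerivAt_id s).const_mul (-(ρ / 2))).exp).const_mul (‖e‖ * (2 * c / ρ)))⟩
    simp only [id, mul_one, inner_zero_right, zero_add]
    have h1 : inner ℝ (v s) e ≤ c * Real.exp (-(ρ / 2 * s)) * ‖e‖ :=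
      (real_inner_le_norm _ _).trans (mul_le_mul_of_nonneg_right hv (norm_nonneg _))
    have h3 : ‖e‖ * (2 * c / ρ) * (Real.exp (-(ρ / 2) * s) * -(ρ / 2)) =
        -(c * Real.exp (-(ρ / 2 * s)) * ‖e‖) := by
      rw [neg_mul]; field_simp
    rw [h3]
    linarith)
  simp only [sub_self, inner_zero_left, mul_zero, Real.exp_zero, mul_one, zero_add, ← he,
    real_inner_self_eq_norm_sq] at key
  have h4 : 0 ≤ ‖e‖ * (2 * c / ρ) * Real.exp (-(ρ / 2) * t) := by positivity
  rcases (norm_nonneg e).eq_or_lt with h | h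
  · rw [← h]; positivity
  · refine le_of_mul_le_mul_left ?_ h
    nlinarith

end Displacement

/-! ### The Jacobian of the network outputs and its Gram matrix -/

section Jacobian

open ContinuousLinearMap

variable {m n p : ℕ}

/-- The parameter space of the hidden layer, with its Euclidean norm. -/
abbrev Params (m p : ℕ) : Type := PiLp 2 (fun _ : Fin m => EuclideanSpace ℝ (Fin p))

instance instContinuousSMulParams (m p : ℕ) : ContinuousSMul ℝ (Params m p) :=
  IsBoundedSMul.continuousSMul

/-- The Jacobian of `W ↦ (f(W, a, xᵢ))ᵢ`, with `s r i` as the value of `σ'(wᵣᵀxᵢ)`. -/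
noncomputable def jacobianLin (x : Fin n → EuclideanSpace ℝ (Fin p)) (a : Fin m → ℝ)
    (s : Fin m → Fin n → ℝ) : Params m p →ₗ[ℝ] EuclideanSpace ℝ (Fin n) where
  toFun v := WithLp.toLp 2 fun i => ∑ r, 1 / Real.sqrt m * a r * s r i * inner ℝ (v r) (x i)
  map_add' v w := by
    ext i
    simp only [PiLp.add_apply, inner_add_left, mul_add, Finset.sum_add_distrib]
  map_smul' c v := by
    ext i
    simp only [PiLp.smul_apply, real_inner_smul_left, RingHom.id_apply, smul_eq_mul,
      Finset.mul_sum]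
    exact Finset.sum_congr rfl fun r _ => by ring

/-- `jacobianLin` as a continuous linear map. -/
noncomputable def jacobian (x : Fin n → EuclideanSpace ℝ (Fin p)) (a : Fin m → ℝ)
    (s : Fin m → Fin n → ℝ) : Params m p →L[ℝ] EuclideanSpace ℝ (Fin n) :=
  (jacobianLin x a s).toContinuousLinearMap

theorem jacobian_apply (x : Fin n → EuclideanSpace ℝ (Fin p)) (a : Fin m → ℝ)
    (s : Fin m → Fin n → ℝ) (v : Params m p) (i : Fin n) :
    jacobian x a s v i = ∑ r, 1 / Real.sqrt m * a r * s r i * inner ℝ (v r) (x i) := rfl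

theorem adjoint_jacobian_apply (x : Fin n → EuclideanSpace ℝ (Fin p)) (a : Fin m → ℝ)
    (s : Fin m → Fin n → ℝ) (z : EuclideanSpace ℝ (Fin n)) :
    adjoint (jacobian x a s) z =
      WithLp.toLp 2 fun r => ∑ i, (z i * (1 / Real.sqrt m * a r * s r i)) • x i := by
  refine ext_inner_left ℝ fun v => ?_
  rw [adjoint_inner_right, PiLp.inner_apply, PiLp.inner_apply]
  simp only [jacobian_apply, RCLike.inner_apply, conj_trivial, inner_sum, Finset.mul_sum,
    real_inner_smul_right]
  rw [Finset.sum_comm]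
  exact Finset.sum_congr rfl fun r _ => Finset.sum_congr rfl fun i _ => by ring

theorem jacobian_sub (x : Fin n → EuclideanSpace ℝ (Fin p)) (a : Fin m → ℝ)
    (s s' : Fin m → Fin n → ℝ) : jacobian x a s - jacobian x a s' = jacobian x a (s - s') := by
  ext v i
  simp only [sub_apply, PiLp.sub_apply, jacobian_apply, Pi.sub_apply, ← Finset.sum_sub_distrib]
  exact Finset.sum_congr rfl fun r _ => by ring

/-- Cauchy–Schwarz over the neurons for each output. The weights s are arbitrary, so by
`jacobian_sub` the bound applies to the difference of two activation patterns. -/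
theorem norm_jacobian_le (x : Fin n → EuclideanSpace ℝ (Fin p)) (hx : ∀ i, ‖x i‖ = 1)
    (a : Fin m → ℝ) (ha : ∀ r, a r ^ 2 = 1) (s : Fin m → Fin n → ℝ) {c : ℝ} (hc : 0 ≤ c)
    (hs : 1 / (m : ℝ) * ∑ i, ∑ r, s r i ^ 2 ≤ c ^ 2) : ‖jacobian x a s‖ ≤ c := by
  refine opNorm_le_bound _ hc fun v => ?_
  refine le_of_sq_le_sq ?_ (by positivity)
  rw [EuclideanSpace.real_norm_sq_eq, mul_pow]
  have hv : ‖v‖ ^ 2 = ∑ r, ‖v r‖ ^ 2 := PiLp.norm_sq_eq_of_L2 _ v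
  calc ∑ i, (jacobian x a s v i) ^ 2
      ≤ ∑ i, (∑ r, 1 / (m : ℝ) * s r i ^ 2) * ∑ r, ‖v r‖ ^ 2 := by
        refine Finset.sum_le_sum fun i _ => ?_
        rw [jacobian_apply]
        refine (Finset.sum_mul_sq_le_sq_mul_sq _ _ _).trans ?_
        refine mul_le_mul (le_of_eq ?_) ?_ (by positivity) (by positivity)
        · refine Finset.sum_congr rfl fun r _ => ?_
          rw [mul_pow, mul_pow, ha r, div_pow, Real.sq_sqrt (Nat.cast_nonneg m)]
          ring
        · refine Finset.sum_le_sum fun r _ => ?_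
          rw [← sq_abs]
          gcongr
          simpa [hx i] using abs_real_inner_le_norm (v r) (x i)
    _ = (1 / (m : ℝ) * ∑ i, ∑ r, s r i ^ 2) * ‖v‖ ^ 2 := by
        rw [← Finset.sum_mul, hv]; simp only [Finset.mul_sum]
    _ ≤ _ := by gcongr

open Classical in
/-- The activation pattern `𝟙(wᵣᵀxᵢ ≥ 0)`. -/
noncomputable def activation (x : Fin n → EuclideanSpace ℝ (Fin p))
    (W : Fin m → EuclideanSpace ℝ (Fin p)) (r : Fin m) (i : Fin n) : ℝ :=
  if 0 ≤ inner ℝ (W r) (x i) then 1 else 0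

/-- The kernel is the Gram matrix J J† of the Jacobian with the pattern 𝟙(z ≥ 0), the signs dropping
out since aᵣ² = 1. A lower bound on the kernel is thus the coercivity needed in the Lyapunov
argument. -/
theorem norm_sq_adjoint_jacobian (x : Fin n → EuclideanSpace ℝ (Fin p))
    (a : Fin m → ℝ) (ha : ∀ r, a r ^ 2 = 1) (W : Fin m → EuclideanSpace ℝ (Fin p))
    (z : EuclideanSpace ℝ (Fin n)) :
    ‖adjoint (jacobian x a (activation x W)) z‖ ^ 2 =
      (fun i => z i) ⬝ᵥ (ntkMatrix x W).mulVec (fun i => z i) := by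
  rw [adjoint_jacobian_apply, PiLp.norm_sq_eq_of_L2]
  simp only [dotProduct, Matrix.mulVec, ntkMatrix, Matrix.of_apply, Finset.mul_sum,
    Finset.sum_mul]
  have h1 : ∀ r, ‖∑ i, (z i * (1 / Real.sqrt m * a r * activation x W r i)) • x i‖ ^ 2 =
      ∑ i, ∑ j, z i * (1 / (m : ℝ) * inner ℝ (x i) (x j) *
        (if 0 ≤ inner ℝ (W r) (x i) ∧ 0 ≤ inner ℝ (W r) (x j) then (1 : ℝ) else 0) * z j) := by
    intro r
    rw [← real_inner_self_eq_norm_sq, sum_inner]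
    refine Finset.sum_congr rfl fun i _ => ?_
    rw [inner_sum]
    refine Finset.sum_congr rfl fun j _ => ?_
    rw [real_inner_smul_left, real_inner_smul_right]
    have e1 : 1 / (m : ℝ) = (1 / Real.sqrt m * a r) * (1 / Real.sqrt m * a r) := by
      have : (1 / Real.sqrt m * a r) * (1 / Real.sqrt m * a r) =
        1 / (Real.sqrt m) ^ 2 * a r ^ 2 := by ring
      rw [this, ha, Real.sq_sqrt (Nat.cast_nonneg m), mul_one]
    have e2 : (if 0 ≤ inner ℝ (W r) (x i) ∧ 0 ≤ inner ℝ (W r) (x j) then (1 : ℝ) else 0) =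
        activation x W r i * activation x W r j := by
      unfold activation
      split_ifs <;> simp_all
    rw [e1, e2]
    ring
  simp only [h1]
  rw [Finset.sum_comm]
  refine Finset.sum_congr rfl fun i _ => ?_
  rw [Finset.sum_comm]

end Jacobian

open Set ContinuousLinearMap

/-! ### Bootstrap argument along the heavy ball flow -/

section Flow

open Filter in
theorem absolutelyContinuousOnInterval_pi {ι : Type*} [Fintype ι] {X : ι → Type*}
    [∀ i, PseudoMetricSpace (X i)] {f : ℝ → ∀ i, X i} {a b : ℝ}
    (hf : ∀ i, AbsolutelyContinuousOnInterval (fun t => f t i) a b) :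
    AbsolutelyContinuousOnInterval f a b := by
  refine squeeze_zero (fun t ↦ ?_) (fun t ↦ ?_)
    (by simpa using tendsto_finsetSum Finset.univ fun i _ => hf i)
  · exact Finset.sum_nonneg (fun i hi ↦ by positivity)
  · rw [Finset.sum_comm]
    refine Finset.sum_le_sum fun k _ => ?_
    refine (dist_pi_le_iff (Finset.sum_nonneg fun i _ => dist_nonneg)).2 fun i => ?_
    exact Finset.single_le_sum (f := fun i => dist (f (t.2 k).1 i) (f (t.2 k).2 i))
      (fun i _ => dist_nonneg) (Finset.mem_univ i)

theorem absolutelyContinuousOnInterval_toLp {ι : Type*} [Fintype ι] {X : ι → Type*}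
    [∀ i, NormedAddCommGroup (X i)] {f : ℝ → ∀ i, X i} {a b : ℝ}
    (hf : ∀ i, AbsolutelyContinuousOnInterval (fun t => f t i) a b) :
    AbsolutelyContinuousOnInterval (fun t => (WithLp.toLp 2 (f t) : PiLp 2 X)) a b :=
  (PiLp.lipschitzWith_toLp 2 X).comp_absolutelyContinuousOnInterval
    (absolutelyContinuousOnInterval_pi hf)

theorem hasDerivAt_toLp {ι : Type*} [Fintype ι] {X : ι → Type*}
    [∀ i, NormedAddCommGroup (X i)] [∀ i, NormedSpace ℝ (X i)] {f : ℝ → ∀ i, X i} {f' : PiLp 2 X}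
    {t : ℝ} (hf : ∀ i, HasDerivAt (fun τ => f τ i) (f' i) t) :
    HasDerivAt (fun τ => (WithLp.toLp 2 (f τ) : PiLp 2 X)) f' t :=
  (PiLp.hasFDerivAt_toLp 2 (f t)).comp_hasDerivAt t (hasDerivAt_pi.2 hf)

/-- The derivative is absolutely continuous, hence bounded, so the path is Lipschitz by the mean
value inequality. -/
theorem absolutelyContinuousOnInterval_of_hasDerivWithinAt {E : Type*} [NormedAddCommGroup E]
    [NormedSpace ℝ E] {w v : ℝ → E} {T : ℝ} (hT : 0 ≤ T)
    (hw : ∀ t, 0 ≤ t → HasDerivWithinAt w (v t) (Ici 0) t)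
    (hv : AbsolutelyContinuousOnInterval v 0 T) : AbsolutelyContinuousOnInterval w 0 T := by
  obtain ⟨C, hC⟩ := hv.exists_bound
  rw [uIcc_of_le hT] at hC
  have : LipschitzOnWith C.toNNReal w (uIcc 0 T) := by
    rw [uIcc_of_le hT]
    refine (convex_Icc 0 T).lipschitzOnWith_of_nnnorm_hasDerivWithin_le
      (fun t ht => (hw t ht.1).mono Icc_subset_Ici_self) fun t ht => ?_
    rw [← NNReal.coe_le_coe, coe_nnnorm]
    exact (hC t ht).trans (Real.le_coe_toNNReal C)
  exact this.absolutelyContinuousOnInterval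

/-- If a continuous quantity starting at `0` is below `R` whenever it has been at most `R` so far,
then it stays below `R`. -/
theorem forall_lt_of_bootstrap {h : ℝ → ℝ} {R : ℝ} (hc : ContinuousOn h (Ici 0)) (h0 : h 0 < R)
    (hstep : ∀ T, 0 ≤ T → (∀ t ∈ Icc 0 T, h t ≤ R) → h T < R) : ∀ t, 0 ≤ t → h t < R := by
  intro t ht
  by_contra! hlt
  set S := {s | s ∈ Ici (0 : ℝ) ∧ h s ∈ Ici R}
  have hcl : IsClosed S := hc.preimage_isClosed_of_isClosed isClosed_Ici isClosed_Ici
  have hne : S.Nonempty := ⟨t, ht, hlt⟩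
  have hbd : BddBelow S := ⟨0, fun s hs => hs.1⟩
  have hmem := hcl.csInf_mem hne hbd
  -- The first time at which R is reached; it belongs to S because S is closed.
  set τ := sInf S
  have hlt' : ∀ s, 0 ≤ s → s < τ → h s < R := fun s hs hsτ => by
    by_contra! hh
    exact absurd (csInf_le hbd ⟨hs, hh⟩) (not_le.2 hsτ)
  have hτpos : 0 < τ := by
    refine lt_of_le_of_ne hmem.1 fun hτ => ?_
    have := hmem.2
    rw [← hτ] at this
    exact absurd h0 (not_lt.2 this)
  have hτR : h τ ≤ R := by
    have hcont : ContinuousWithinAt h (Ico 0 τ) τ := (hc τ hmem.1).mono Ico_subset_Ici_self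
    have : (nhdsWithin τ (Ico 0 τ)).NeBot := by
      rw [← mem_closure_iff_nhdsWithin_neBot, closure_Ico hτpos.ne]
      exact ⟨hτpos.le, le_rfl⟩
    refine le_of_tendsto hcont ?_
    filter_upwards [self_mem_nhdsWithin] with s hs
    exact (hlt' s hs.1 hs.2).le
  refine absurd (hstep τ hτpos.le fun s hs => ?_) (not_lt.2 hmem.2)
  rcases hs.2.eq_or_lt with h1 | h1
  · rw [h1]; exact hτR
  · exact (hlt' s hs.1 h1).le

variable {m n p : ℕ} {x : Fin n → EuclideanSpace ℝ (Fin p)} {y : Fin n → ℝ} {a : Fin m → ℝ}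

/-- The factor 1/√m in the force on a single neuron is what keeps the weights of a wide network near
their start. Only 0 ≤ s ≤ 1 is used, and the sum over the data costs √n. -/
theorem norm_lossGrad_le (hx : ∀ i, ‖x i‖ = 1) (ha : ∀ r, a r ^ 2 = 1)
    (W : Fin m → EuclideanSpace ℝ (Fin p)) {s : Fin m → Fin n → ℝ}
    (hs : ∀ r i, s r i ∈ reluSubdiff (inner ℝ (W r) (x i))) (r : Fin m) :
    ‖lossGrad x y W a s r‖ ≤
      Real.sqrt n / Real.sqrt m *
        ‖(WithLp.toLp 2 (predError x y W a) : EuclideanSpace ℝ (Fin n))‖ := by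
  have har : |a r| = 1 := by
    rw [← sq_eq_sq₀ (abs_nonneg _) zero_le_one, sq_abs, ha, one_pow]
  have h1 : ‖lossGrad x y W a s r‖ ≤ ∑ i, 1 / Real.sqrt m * |predError x y W a i| := by
    refine (norm_sum_le _ _).trans (Finset.sum_le_sum fun i _ => ?_)
    obtain ⟨hs0, hs1, -, -⟩ := hs r i
    rw [norm_smul, hx, mul_one, Real.norm_eq_abs, abs_mul, abs_mul, abs_mul, har, mul_one,
      abs_of_nonneg hs0, abs_of_nonneg (by positivity : 0 ≤ 1 / Real.sqrt m), mul_comm]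
    exact mul_le_mul_of_nonneg_right (mul_le_of_le_one_right (by positivity) hs1) (abs_nonneg _)
  have h2 : ∑ i, |predError x y W a i| ≤ Real.sqrt n *
      ‖(WithLp.toLp 2 (predError x y W a) : EuclideanSpace ℝ (Fin n))‖ := by
    refine le_of_sq_le_sq ?_ (by positivity)
    rw [mul_pow, Real.sq_sqrt (Nat.cast_nonneg n), EuclideanSpace.real_norm_sq_eq]
    simpa [sq_abs] using sq_sum_le_card_mul_sum_sq (s := Finset.univ)
      (f := fun i => |predError x y W a i|)
  rw [← Finset.mul_sum] at h1
  calc _ ≤ _ := h1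
    _ ≤ 1 / Real.sqrt m * (Real.sqrt n * _) := by gcongr
    _ = _ := by ring

/-- As long as no weight has moved by more than `R`, only the neurons with `|wᵣ(0)ᵀxᵢ| ≤ R` can
have changed their activation pattern. -/
theorem abs_sub_activation_le (hx : ∀ i, ‖x i‖ = 1) {W W₀ : Fin m → EuclideanSpace ℝ (Fin p)}
    {R : ℝ} {r : Fin m} {i : Fin n} (hW : ‖W r - W₀ r‖ ≤ R) {s : ℝ}
    (hs : s ∈ reluSubdiff (inner ℝ (W r) (x i))) [Decidable (|inner ℝ (W₀ r) (x i)| ≤ R)] :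
    (s - activation x W₀ r i) ^ 2 ≤ if |inner ℝ (W₀ r) (x i)| ≤ R then 1 else 0 := by
  obtain ⟨h0, h1, hp, hn⟩ := hs
  have hin : |inner ℝ (W r) (x i) - inner ℝ (W₀ r) (x i)| ≤ R := by
    rw [← inner_sub_left]
    refine (abs_real_inner_le_norm _ _).trans ?_
    rw [hx, mul_one]; exact hW
  rw [abs_le] at hin
  unfold activation
  split_ifs with h2 h3 h3
  · nlinarith
  · rw [abs_of_nonneg h2, not_le] at h3
    rw [hp (by linarith)]; norm_num
  · nlinarith
  · rw [not_le] at h2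
    rw [abs_of_neg h2, not_le] at h3
    rw [hn (by linarith)]; norm_num

/-- The prediction error along a path, as a Euclidean vector. -/
noncomputable def errorVec (x : Fin n → EuclideanSpace ℝ (Fin p)) (y : Fin n → ℝ) (a : Fin m → ℝ)
    (W : Fin m → EuclideanSpace ℝ (Fin p)) : EuclideanSpace ℝ (Fin n) :=
  WithLp.toLp 2 (predError x y W a)

theorem loss_eq_norm_sq_errorVec (W : Fin m → EuclideanSpace ℝ (Fin p)) :
    loss x y W a = 1 / 2 * ‖errorVec x y a W‖ ^ 2 := by
  rw [EuclideanSpace.real_norm_sq_eq]; rfl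

theorem absolutelyContinuousOnInterval_relu_inner {w : ℝ → EuclideanSpace ℝ (Fin p)} {T : ℝ}
    (hw : AbsolutelyContinuousOnInterval w 0 T) (u : EuclideanSpace ℝ (Fin p)) :
    AbsolutelyContinuousOnInterval (fun t => relu (inner ℝ (w t) u)) 0 T :=
  lipschitzWith_relu.comp_absolutelyContinuousOnInterval
    (hw.real_inner (absolutelyContinuousOnInterval_const u 0 T))

theorem absolutelyContinuousOnInterval_errorVec {W : ℝ → Fin m → EuclideanSpace ℝ (Fin p)} {T : ℝ}
    (hW : ∀ r, AbsolutelyContinuousOnInterval (fun t => W t r) 0 T) :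
    AbsolutelyContinuousOnInterval (fun t => errorVec x y a (W t)) 0 T := by
  refine absolutelyContinuousOnInterval_toLp fun i => ?_
  exact ((AbsolutelyContinuousOnInterval.finset_sum _ fun r _ =>
    (absolutelyContinuousOnInterval_relu_inner (hW r) (x i)).const_mul (a r)).const_mul _).fun_sub
      (absolutelyContinuousOnInterval_const (y i) 0 T)

/-- The chain rule for the prediction error, with arbitrary subgradients of the ReLU. -/
theorem hasDerivAt_errorVec {W : ℝ → Fin m → EuclideanSpace ℝ (Fin p)} {V : Params m p} {t : ℝ}
    (hW : ∀ r, HasDerivAt (fun τ => W τ r) (V r) t)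
    (hd : ∀ r i, DifferentiableAt ℝ (fun τ => relu (inner ℝ (W τ r) (x i))) t)
    {s : Fin m → Fin n → ℝ} (hs : ∀ r i, s r i ∈ reluSubdiff (inner ℝ (W t r) (x i))) :
    HasDerivAt (fun τ => errorVec x y a (W τ)) (jacobian x a s V) t := by
  refine hasDerivAt_toLp fun i => ?_
  rw [jacobian_apply]
  have h1 : ∀ r, HasDerivAt (fun τ => relu (inner ℝ (W τ r) (x i)))
      (s r i * inner ℝ (V r) (x i)) t := by
    intro r
    have := (hW r).inner ℝ (hasDerivAt_const t (x i))
    simp only [inner_zero_right, zero_add] at this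
    exact hasDerivAt_relu_comp this (hd r i) (hs r i)
  have h2 := (((HasDerivAt.fun_sum (u := Finset.univ) fun r _ =>
    (h1 r).const_mul (a r)).const_mul (1 / Real.sqrt m)).sub_const (y i))
  refine h2.congr_deriv ?_
  rw [Finset.mul_sum]
  exact Finset.sum_congr rfl fun r _ => by ring

open Classical in
/-- The number of pairs `(r, i)` with `|wᵣᵀxᵢ| ≤ R`, divided by `m`. -/
noncomputable def flipFraction (x : Fin n → EuclideanSpace ℝ (Fin p)) (R : ℝ)
    (W : Fin m → EuclideanSpace ℝ (Fin p)) : ℝ :=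
  1 / (m : ℝ) * ∑ i, ∑ r, if |inner ℝ (W r) (x i)| ≤ R then 1 else 0

/-- Convergence of the heavy ball flow from an initialization at which the kernel is
well conditioned, few neurons are close to a kink and the error is not too large. -/
theorem norm_sq_errorVec_le_of_isHeavyBallFlow {ρ R : ℝ} (hρ : 0 < ρ) (hx : ∀ i, ‖x i‖ = 1)
    (ha : ∀ r, a r ^ 2 = 1) {W₀ : Fin m → EuclideanSpace ℝ (Fin p)}
    (hH : ∀ z : Fin n → ℝ, 9 / 5 * ρ ^ 2 * ∑ i, z i ^ 2 ≤ z ⬝ᵥ (ntkMatrix x W₀).mulVec z)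
    (hflip : flipFraction x R W₀ ≤ (ρ / 6) ^ 2)
    (hR : 8 / (3 * ρ ^ 2) * (Real.sqrt n / Real.sqrt m * ‖errorVec x y a W₀‖) < R)
    {W : ℝ → Fin m → EuclideanSpace ℝ (Fin p)} (hW0 : W 0 = W₀)
    (hflow : IsHeavyBallFlow (2 * ρ) x y a W) {t : ℝ} (ht : 0 ≤ t) :
    ‖errorVec x y a (W t)‖ ^ 2 ≤ 16 / 7 * Real.exp (-(ρ * t)) * ‖errorVec x y a W₀‖ ^ 2 := by
  classical
  obtain ⟨V, hWV, hV0, hVac, hode⟩ := hflow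
  have hWac : ∀ T, 0 ≤ T → ∀ r, AbsolutelyContinuousOnInterval (fun τ => W τ r) 0 T :=
    fun T hT r => absolutelyContinuousOnInterval_of_hasDerivWithinAt hT
      (fun t ht => hWV t ht r) (hVac T hT r)
  have hWd : ∀ t, 0 < t → ∀ r, HasDerivAt (fun τ => W τ r) (V t r) t := fun t ht r =>
    (hWV t ht.le r).hasDerivAt (Ici_mem_nhds ht)
  have hode' := (ae_restrict_iff' measurableSet_Ici).1 hode
  have hA : ∀ z, 9 / 5 * ρ ^ 2 * ‖z‖ ^ 2 ≤
      ‖adjoint (jacobian x a (activation x W₀)) z‖ ^ 2 := by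
    intro z
    rw [norm_sq_adjoint_jacobian x a ha, EuclideanSpace.real_norm_sq_eq]
    exact hH _
  have hdecay : ∀ T, 0 ≤ T → (∀ t ∈ Icc 0 T, ∀ r, ‖W t r - W₀ r‖ ≤ R) → ∀ t ∈ Icc 0 T,
      ‖errorVec x y a (W t)‖ ^ 2 ≤ 16 / 7 * Real.exp (-(ρ * t)) * ‖errorVec x y a W₀‖ ^ 2 := by
    intro T hT hclose t ht
    -- Each relu(wᵣᵀxᵢ) is absolutely continuous in time, hence differentiable almost everywhere, as
    -- the chain rule requires.
    have hrelu : ∀ᵐ t, t ∈ Ioo 0 T → ∀ r i,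
        DifferentiableAt ℝ (fun τ => relu (inner ℝ (W τ r) (x i))) t := by
      have : ∀ᵐ t, ∀ r i, t ∈ uIcc 0 T →
          DifferentiableAt ℝ (fun τ => relu (inner ℝ (W τ r) (x i))) t := by
        rw [ae_all_iff]; intro r
        rw [ae_all_iff]; intro i
        exact (absolutelyContinuousOnInterval_relu_inner (hWac T hT r) (x i)).ae_differentiableAt
      filter_upwards [this] with t h1 h2 r i
      exact h1 r i (by rw [uIcc_of_le hT]; exact Ioo_subset_Icc_self h2)
    have := norm_sq_le_exp_of_heavyBall (U := EuclideanSpace ℝ (Fin n)) (F := Params m p)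
      (D := fun t => errorVec x y a (W t)) (V := fun t => WithLp.toLp 2 (V t)) (T := T) hρ
      (jacobian x a (activation x W₀)) hA
      (absolutelyContinuousOnInterval_errorVec (hWac T hT))
      (absolutelyContinuousOnInterval_toLp (hVac T hT))
      (by ext1 r; exact hV0 r) (by
        filter_upwards [hode', hrelu] with t ht1 ht2 htT
        obtain ⟨s, hs, hA⟩ := ht1 htT.1.le
        refine ⟨jacobian x a s, ?_, hasDerivAt_errorVec (hWd t htT.1) (ht2 htT) hs, ?_⟩
        · rw [jacobian_sub]
          refine norm_jacobian_le x hx a ha _ (by positivity) (le_trans ?_ hflip)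
          refine mul_le_mul_of_nonneg_left ?_ (by positivity)
          refine Finset.sum_le_sum fun i _ => Finset.sum_le_sum fun r _ => ?_
          exact abs_sub_activation_le hx (hclose t (Ioo_subset_Icc_self htT) r) (hs r i)
        · refine hasDerivAt_toLp fun r => ?_
          obtain ⟨A, hA1, hA2⟩ := hA r
          refine hA1.congr_deriv ?_
          rw [adjoint_jacobian_apply]
          have : A = -((2 * ρ) • V t r) - lossGrad x y (W t) a s r := by
            rw [← sub_eq_zero, ← hA2]; abel
          rw [this]
          rfl) ht
    simpa only [hW0] using this
  -- The 2 bounds √(16/7).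
  set K := 2 * (Real.sqrt n / Real.sqrt m * ‖errorVec x y a W₀‖) with hK
  have hKnn : 0 ≤ K := by positivity
  have hdisp : ∀ T, 0 ≤ T → (∀ t ∈ Icc 0 T, ∀ r, ‖W t r - W₀ r‖ ≤ R) →
      ∀ r, ‖W T r - W₀ r‖ < R := by
    intro T hT hclose r
    have hvel : ∀ t ∈ Icc 0 T, ‖V t r‖ ≤ 2 * K / (3 * ρ) * Real.exp (-(ρ / 2 * t)) := by
      intro t ht
      refine norm_velocity_le hρ hKnn (hVac T hT r) (hV0 r) ?_ ht
      filter_upwards [hode'] with s hs hsT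
      obtain ⟨σ, hσ, hA⟩ := hs hsT.1.le
      obtain ⟨A, hA1, hA2⟩ := hA r
      refine ⟨lossGrad x y (W s) a σ r, ?_, hA1.congr_deriv ?_⟩
      · refine (norm_lossGrad_le hx ha (W s) hσ r).trans ?_
        have h1 := hdecay T hT hclose s (Ioo_subset_Icc_self hsT)
        have h2 : ‖errorVec x y a (W s)‖ ≤
            2 * Real.exp (-(ρ / 2 * s)) * ‖errorVec x y a W₀‖ := by
          refine le_of_sq_le_sq ?_ (by positivity)
          have h3 : Real.exp (-(ρ * s)) = Real.exp (-(ρ / 2 * s)) ^ 2 := by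
            rw [← Real.exp_nat_mul]; congr 1; push_cast; ring
          rw [h3] at h1
          nlinarith [sq_nonneg (Real.exp (-(ρ / 2 * s)) * ‖errorVec x y a W₀‖)]
        calc _ ≤ Real.sqrt n / Real.sqrt m *
              (2 * Real.exp (-(ρ / 2 * s)) * ‖errorVec x y a W₀‖) := by gcongr; exact h2
          _ = _ := by rw [hK]; ring
      · rw [← sub_eq_zero, ← hA2]; abel
    have h1 := norm_displacement_le hρ (by positivity) (hWac T hT r)
      (fun s hs => ⟨hWd s hs.1 r, hvel s (Ioo_subset_Icc_self hs)⟩) (right_mem_Icc.2 hT)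
    rw [hW0] at h1
    refine h1.trans_lt (lt_of_eq_of_lt ?_ hR)
    rw [hK]; field_simp; ring
  have hR0 : 0 < R := lt_of_le_of_lt (by positivity) hR
  -- The supremum norm over neurons turns the bootstrap into one for a single real function.
  have hnn : ∀ s, ∀ c : ℝ, 0 ≤ c → ((∀ r, ‖W s r - W₀ r‖ ≤ c) ↔ ‖W s - W₀‖ ≤ c) :=
    fun s c hc => (pi_norm_le_iff_of_nonneg hc).symm
  have hcont : ContinuousOn (fun s => ‖W s - W₀‖) (Ici 0) := by
    refine ContinuousOn.norm (ContinuousOn.sub (continuousOn_pi.2 fun r s hs => ?_)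
      continuousOn_const)
    exact (hWV s hs r).continuousWithinAt
  have hall := forall_lt_of_bootstrap hcont (by simpa [hW0] using hR0) fun T hT hc =>
    (pi_norm_lt_iff hR0).2 (hdisp T hT fun s hs => (hnn s R hR0.le).2 (hc s hs))
  exact hdecay t ht (fun s hs => (hnn s R hR0.le).2 (hall s hs.1).le) t (right_mem_Icc.2 ht)

end Flow

/-! ### Smallest eigenvalue and perturbation of quadratic forms -/

section Spectral

variable {n : ℕ}

/-- Subtracting `lambdaMin A` times the identity shifts the spectrum to nonnegative values, so the
Hermitian difference is positive semidefinite. -/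
theorem lambdaMin_mul_sum_sq_le {A : Matrix (Fin n) (Fin n) ℝ} (hA : A.IsHermitian)
    (z : Fin n → ℝ) : lambdaMin A * ∑ i, z i ^ 2 ≤ z ⬝ᵥ A.mulVec z := by
  have hle : ∀ μ ∈ spectrum ℝ A, lambdaMin A ≤ μ := by
    intro μ hμ
    refine csInf_le ?_ ?_
    · refine Set.Finite.bddBelow ?_
      exact Module.End.finite_hasEigenvalue _
    · rw [Set.mem_ofPred_eq, Module.End.hasEigenvalue_iff_mem_spectrum, Matrix.spectrum_toLin']
      exact hμ
  have hpsd : (A - algebraMap ℝ _ (lambdaMin A)).PosSemidef := by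
    rw [Matrix.posSemidef_iff_isHermitian_and_spectrum_nonneg]
    refine ⟨hA.sub ?_, fun μ hμ => ?_⟩
    · rw [Algebra.algebraMap_eq_smul_one]
      exact Matrix.isHermitian_one.smul (IsSelfAdjoint.all _)
    · rw [← spectrum.sub_singleton_eq] at hμ
      obtain ⟨ν, hν, c, hc, rfl⟩ := hμ
      rw [Set.mem_singleton_iff] at hc
      subst hc
      exact sub_nonneg.2 (hle ν hν)
  have h := hpsd.dotProduct_mulVec_nonneg z
  rw [Matrix.sub_mulVec, dotProduct_sub, Algebra.algebraMap_eq_smul_one, Matrix.smul_mulVec,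
    Matrix.one_mulVec, dotProduct_smul] at h
  simp only [star_trivial, smul_eq_mul, dotProduct, sub_nonneg] at h ⊢
  simpa only [sq] using h

/-- A quadratic form moves by at most the Frobenius norm of the perturbation of its matrix. -/
theorem dotProduct_mulVec_ge_sub {A H : Matrix (Fin n) (Fin n) ℝ} {c : ℝ} (hc : 0 ≤ c)
    (h : ∑ i, ∑ j, (H i j - A i j) ^ 2 ≤ c ^ 2) (z : Fin n → ℝ) :
    z ⬝ᵥ A.mulVec z - c * ∑ i, z i ^ 2 ≤ z ⬝ᵥ H.mulVec z := by
  have hdiff : z ⬝ᵥ H.mulVec z - z ⬝ᵥ A.mulVec z =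
      ∑ ij : Fin n × Fin n, (H ij.1 ij.2 - A ij.1 ij.2) * (z ij.1 * z ij.2) := by
    rw [← dotProduct_sub, ← Matrix.sub_mulVec, Fintype.sum_prod_type]
    simp only [dotProduct, Matrix.mulVec, Finset.mul_sum, Matrix.sub_apply]
    exact Finset.sum_congr rfl fun i _ => Finset.sum_congr rfl fun j _ => by ring
  have hcs := Finset.sum_mul_sq_le_sq_mul_sq (Finset.univ : Finset (Fin n × Fin n))
    (fun ij => H ij.1 ij.2 - A ij.1 ij.2) (fun ij => z ij.1 * z ij.2)
  rw [← hdiff, Fintype.sum_prod_type, Fintype.sum_prod_type] at hcs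
  have hz : ∑ i, ∑ j, (z i * z j) ^ 2 = (∑ i, z i ^ 2) ^ 2 := by
    rw [sq (∑ i, z i ^ 2), Finset.sum_mul_sum]
    simp only [mul_pow]
  simp only [hz] at hcs
  have h1 : (z ⬝ᵥ H.mulVec z - z ⬝ᵥ A.mulVec z) ^ 2 ≤ (c * ∑ i, z i ^ 2) ^ 2 := by
    rw [mul_pow]
    exact hcs.trans (mul_le_mul_of_nonneg_right h (sq_nonneg _))
  have h2 := abs_le_of_sq_le_sq' h1 (mul_nonneg hc (Finset.sum_nonneg fun i _ => sq_nonneg _))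
  linarith [h2.1]

theorem isHermitian_limitNTK {p : ℕ} (x : Fin n → EuclideanSpace ℝ (Fin p)) :
    (limitNTK x).IsHermitian := by
  ext i j
  simp only [Matrix.conjTranspose_apply, limitNTK, Matrix.of_apply, star_trivial,
    real_inner_comm (x i) (x j)]
  congr 1
  ext w
  congr 1
  simp only [and_comm]

end Spectral

/-! ### Markov's inequality and moments of Gaussians and random signs -/

section Moments

open Classical in
/-- The summand `xᵀx' 𝟙(wᵀx ≥ 0, wᵀx' ≥ 0)` of the kernel. -/
noncomputable def kernelTerm {p : ℕ} (u v w : EuclideanSpace ℝ (Fin p)) : ℝ :=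
  inner ℝ u v * (if 0 ≤ inner ℝ w u ∧ 0 ≤ inner ℝ w v then (1 : ℝ) else 0)

theorem measurable_kernelTerm {p : ℕ} (u v : EuclideanSpace ℝ (Fin p)) :
    Measurable (kernelTerm u v) := by
  refine Measurable.const_mul (Measurable.ite ?_ measurable_const measurable_const) _
  have h : ∀ z : EuclideanSpace ℝ (Fin p), MeasurableSet {w | 0 ≤ inner ℝ w z} := fun z =>
    measurableSet_le measurable_const (by fun_prop)
  exact (h u).inter (h v)

theorem abs_kernelTerm_le {p : ℕ} {u v : EuclideanSpace ℝ (Fin p)} (hu : ‖u‖ = 1) (hv : ‖v‖ = 1)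
    (w : EuclideanSpace ℝ (Fin p)) : |kernelTerm u v w| ≤ 1 := by
  have h := abs_real_inner_le_norm u v
  rw [hu, hv, mul_one] at h
  unfold kernelTerm
  split_ifs
  · simpa using h
  · simp

theorem ntkMatrix_apply {m n p : ℕ} (x : Fin n → EuclideanSpace ℝ (Fin p))
    (W : Fin m → EuclideanSpace ℝ (Fin p)) (i j : Fin n) :
    ntkMatrix x W i j = ∑ r, 1 / (m : ℝ) * kernelTerm (x i) (x j) (W r) := by
  simp only [ntkMatrix, Matrix.of_apply, kernelTerm, Finset.mul_sum, mul_assoc]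

theorem limitNTK_apply {n p : ℕ} (x : Fin n → EuclideanSpace ℝ (Fin p)) (i j : Fin n) :
    limitNTK x i j = ∫ w, kernelTerm (x i) (x j) w ∂(stdGaussian (EuclideanSpace ℝ (Fin p))) := rfl

theorem memLp_kernelTerm {p : ℕ} {u v : EuclideanSpace ℝ (Fin p)} (hu : ‖u‖ = 1) (hv : ‖v‖ = 1)
    (q : ENNReal) : MemLp (kernelTerm u v) q (stdGaussian (EuclideanSpace ℝ (Fin p))) :=
  MemLp.of_bound (measurable_kernelTerm u v).aestronglyMeasurable 1
    (Filter.Eventually.of_forall fun w => abs_kernelTerm_le hu hv w)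

/-- A coordinate vector tests the quadratic form by a diagonal entry. The bound lets the width
condition absorb lower powers of 1/λ₀. -/
theorem lambdaMin_limitNTK_le_one {n p : ℕ} (hn : 0 < n) {x : Fin n → EuclideanSpace ℝ (Fin p)}
    (hx : ∀ i, ‖x i‖ = 1) : lambdaMin (limitNTK x) ≤ 1 := by
  have h := lambdaMin_mul_sum_sq_le (isHermitian_limitNTK x) (Pi.single ⟨0, hn⟩ 1)
  simp only [Matrix.mulVec_single_one, single_one_dotProduct, Matrix.col_apply, limitNTK_apply]
    at h
  have h1 : ∑ i, (Pi.single (⟨0, hn⟩ : Fin n) (1 : ℝ) : Fin n → ℝ) i ^ 2 = 1 := by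
    simp [Pi.single_apply]
  rw [h1, mul_one] at h
  refine h.trans ?_
  have h2 := norm_integral_le_of_norm_le_const (μ := stdGaussian (EuclideanSpace ℝ (Fin p)))
    (f := kernelTerm (x ⟨0, hn⟩) (x ⟨0, hn⟩)) (C := 1)
    (Filter.Eventually.of_forall fun w => abs_kernelTerm_le (hx ⟨0, hn⟩) (hx ⟨0, hn⟩) w)
  rw [probReal_univ, mul_one] at h2
  exact (le_abs_self _).trans h2

/-- **Markov's inequality** in the form used here. -/
theorem measure_ge_le_of_lintegral_le {Ω : Type*} [MeasurableSpace Ω] {μ : Measure Ω} {f : Ω → ℝ}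
    (hf : Measurable f) {c θ η : ℝ} (hθ : 0 < θ) (hc : c ≤ η * θ)
    (h : ∫⁻ ω, ENNReal.ofReal (f ω) ∂μ ≤ ENNReal.ofReal c) :
    μ {ω | θ ≤ f ω} ≤ ENNReal.ofReal η := by
  have h1 := mul_meas_ge_le_lintegral (μ := μ) hf.ennreal_ofReal (ENNReal.ofReal θ)
  have h2 : μ {ω | θ ≤ f ω} ≤ μ {ω | ENNReal.ofReal θ ≤ ENNReal.ofReal (f ω)} :=
    measure_mono fun ω hω => ENNReal.ofReal_le_ofReal hω
  have h3 : ENNReal.ofReal θ * μ {ω | θ ≤ f ω} ≤ ENNReal.ofReal θ * ENNReal.ofReal η := by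
    rw [← ENNReal.ofReal_mul hθ.le]
    refine (mul_le_mul_right h2 _).trans (h1.trans (h.trans (ENNReal.ofReal_le_ofReal ?_)))
    linarith
  exact (ENNReal.mul_le_mul_iff_right (by simpa using hθ) ENNReal.ofReal_ne_top).1 h3

/-- The second moment of a centred sum of independent variables. -/
theorem lintegral_sq_sum_sub_pi {ι Ω : Type*} [Fintype ι] [MeasurableSpace Ω] {μ : Measure Ω}
    [IsProbabilityMeasure μ] {X : ι → Ω → ℝ} (hX : ∀ r, MemLp (X r) 2 μ) :
    ∫⁻ ω, ENNReal.ofReal ((∑ r, X r (ω r) - ∑ r, μ[X r]) ^ 2) ∂(Measure.pi fun _ : ι => μ) =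
      ENNReal.ofReal (∑ r, Var[X r; μ]) := by
  have hX' : ∀ r, MemLp (fun ω : ι → Ω => X r (ω r)) 2 (Measure.pi fun _ : ι => μ) := fun r =>
    (hX r).comp_measurePreserving (measurePreserving_eval (fun _ : ι => μ) r)
  have hS : MemLp (fun ω : ι → Ω => ∑ r, X r (ω r)) 2 (Measure.pi fun _ : ι => μ) :=
    memLp_finsetSum _ fun r _ => hX' r
  have hmean : ∫ ω, ∑ r, X r (ω r) ∂(Measure.pi fun _ : ι => μ) = ∑ r, μ[X r] := by
    rw [integral_finsetSum _ fun r _ => (hX' r).integrable (by norm_num)]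
    exact Finset.sum_congr rfl fun r _ =>
      integral_comp_eval (μ := fun _ : ι => μ) (hX r).aestronglyMeasurable
  have hvar := variance_sum_pi (μ := fun _ : ι => μ) hX
  rw [show (∑ r, fun ω : ι → Ω => X r (ω r)) = fun ω => ∑ r, X r (ω r) by
    ext ω; simp, variance_eq_integral hS.aemeasurable, hmean] at hvar
  rw [← hvar, ofReal_integral_eq_lintegral_ofReal]
  · exact (hS.sub (memLp_const _)).integrable_sq
  · exact Filter.Eventually.of_forall fun ω => sq_nonneg _

theorem map_inner_stdGaussian {p : ℕ} {u : EuclideanSpace ℝ (Fin p)} (hu : ‖u‖ = 1) :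
    (stdGaussian (EuclideanSpace ℝ (Fin p))).map (fun w => inner ℝ w u) = gaussianReal 0 1 := by
  have h := IsGaussian.map_eq_gaussianReal (μ := stdGaussian (EuclideanSpace ℝ (Fin p)))
    (innerSL ℝ u)
  rw [integral_strongDual_stdGaussian, variance_dual_stdGaussian, innerSL_apply_norm, hu] at h
  simp only [one_pow, Real.toNNReal_one] at h
  rw [← h]
  congr 1
  ext w
  simp [real_inner_comm]

/-- The density is at most 1/√(2π) ≤ 1/2 and the interval has length 2R. -/
theorem gaussianReal_Icc_le (R : ℝ) :
    gaussianReal 0 1 (Set.Icc (-R) R) ≤ ENNReal.ofReal R := by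
  rw [gaussianReal_apply _ one_ne_zero]
  have hpi : (2 : ℝ) ≤ Real.sqrt (2 * Real.pi) :=
    Real.le_sqrt_of_sq_le (by nlinarith [Real.pi_gt_three])
  have h : ∀ z, gaussianPDF 0 1 z ≤ ENNReal.ofReal (1 / 2) := by
    intro z
    refine ENNReal.ofReal_le_ofReal ?_
    rw [gaussianPDFReal]
    have h1 : Real.exp (-(z - 0) ^ 2 / (2 * ((1 : NNReal) : ℝ))) ≤ 1 :=
      Real.exp_le_one_iff.2 (by rw [neg_div, neg_nonpos]; positivity)
    have h2 : (Real.sqrt (2 * Real.pi * ((1 : NNReal) : ℝ)))⁻¹ ≤ 1 / 2 := by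
      rw [NNReal.coe_one, mul_one, one_div]
      exact inv_anti₀ (by norm_num) hpi
    exact (mul_le_of_le_one_right (by positivity) h1).trans h2
  calc _ ≤ ∫⁻ _ in Set.Icc (-R) R, ENNReal.ofReal (1 / 2) := lintegral_mono fun z => h z
    _ = ENNReal.ofReal R := by
      rw [setLIntegral_const, Real.volume_Icc, ← ENNReal.ofReal_mul (by norm_num)]
      congr 1; ring

theorem lintegral_sq_inner_stdGaussian {p : ℕ} {u : EuclideanSpace ℝ (Fin p)} (hu : ‖u‖ = 1) :
    ∫⁻ w, ENNReal.ofReal (inner ℝ w u ^ 2) ∂(stdGaussian (EuclideanSpace ℝ (Fin p))) = 1 := by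
  have h1 : ∫⁻ z, ENNReal.ofReal (z ^ 2) ∂(gaussianReal 0 1) = 1 := by
    rw [← ofReal_integral_eq_lintegral_ofReal]
    · have := variance_of_integral_eq_zero (X := fun z => z) (μ := gaussianReal 0 1)
        aemeasurable_id integral_id_gaussianReal
      rw [← this, variance_fun_id_gaussianReal]
      simp
    · exact (memLp_id_gaussianReal 2).integrable_sq
    · exact Filter.Eventually.of_forall fun z => sq_nonneg z
  rw [← h1, ← map_inner_stdGaussian hu, lintegral_map (by fun_prop) (by fun_prop)]

instance : IsProbabilityMeasure signMeasure := by
  constructor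
  simp [signMeasure, ENNReal.inv_two_add_inv_two]

theorem memLp_id_signMeasure : MemLp (fun z : ℝ => z) 2 signMeasure := by
  refine MemLp.of_bound aestronglyMeasurable_id 1 ?_
  simp [signMeasure, ae_add_measure_iff, ae_dirac_eq]

theorem ae_sq_eq_one_signMeasure : ∀ᵐ z ∂signMeasure, z ^ 2 = 1 := by
  simp [signMeasure, ae_add_measure_iff, ae_dirac_eq]

theorem integral_id_signMeasure : ∫ z, z ∂signMeasure = 0 := by
  rw [signMeasure, integral_add_measure, integral_smul_measure, integral_smul_measure]
  · simp
  · exact (integrable_dirac (by simp)).smul_measure (by simp)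
  · exact (integrable_dirac (by simp)).smul_measure (by simp)

theorem variance_id_signMeasure : Var[fun z => z; signMeasure] = 1 := by
  rw [variance_of_integral_eq_zero memLp_id_signMeasure.aemeasurable integral_id_signMeasure,
    integral_congr_ae ae_sq_eq_one_signMeasure]
  simp

end Moments

/-! ### Probability bounds at initialization -/

section Initialization

variable {m n p : ℕ} {x : Fin n → EuclideanSpace ℝ (Fin p)}

instance : IsProbabilityMeasure (initLaw m p) := by
  unfold initLaw; infer_instance

theorem initLaw_fst_preimage {S : Set (Fin m → EuclideanSpace ℝ (Fin p))} (hS : MeasurableSet S) :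
    initLaw m p {ω | ω.1 ∈ S} =
      (Measure.pi fun _ : Fin m => stdGaussian (EuclideanSpace ℝ (Fin p))) S :=
  measurePreserving_fst.measure_preimage hS.nullMeasurableSet

theorem ae_sq_eq_one_initLaw : ∀ᵐ ω ∂(initLaw m p), ∀ r, ω.2 r ^ 2 = 1 := by
  have h : ∀ᵐ a ∂(Measure.pi fun _ : Fin m => signMeasure), ∀ r, a r ^ 2 = 1 := by
    rw [ae_all_iff]
    intro r
    exact (measurePreserving_eval (fun _ : Fin m => signMeasure) r).quasiMeasurePreserving.ae
      ae_sq_eq_one_signMeasure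
  exact measurePreserving_snd.quasiMeasurePreserving.ae h

/-- An entry of the kernel is an average of m independent copies of a variable with values in [−1,
1] whose mean is the limit entry. -/
theorem lintegral_sq_ntkMatrix_sub_le (hm : 0 < m) (hx : ∀ i, ‖x i‖ = 1) (i j : Fin n) :
    ∫⁻ W, ENNReal.ofReal ((ntkMatrix x W i j - limitNTK x i j) ^ 2)
      ∂(Measure.pi fun _ : Fin m => stdGaussian (EuclideanSpace ℝ (Fin p))) ≤
      ENNReal.ofReal (1 / m) := by
  have hm' : (0 : ℝ) < m := Nat.cast_pos.2 hm
  have h := lintegral_sq_sum_sub_pi (ι := Fin m)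
    (X := fun _ w => 1 / (m : ℝ) * kernelTerm (x i) (x j) w)
    fun _ => (memLp_kernelTerm (hx i) (hx j) 2).const_mul (1 / (m : ℝ))
  simp only [integral_const_mul, ← limitNTK_apply, ← ntkMatrix_apply, Finset.sum_const,
    Finset.card_univ, Fintype.card_fin, nsmul_eq_mul, variance_const_mul] at h
  rw [show (m : ℝ) * (1 / m * limitNTK x i j) = limitNTK x i j by field_simp] at h
  rw [h]
  refine ENNReal.ofReal_le_ofReal ?_
  have hv : Var[fun w => kernelTerm (x i) (x j) w; stdGaussian (EuclideanSpace ℝ (Fin p))] ≤ 1 := by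
    refine (variance_le_sq_of_bounded (a := -1) (b := 1) (Filter.Eventually.of_forall fun w =>
      abs_le.1 (abs_kernelTerm_le (hx i) (hx j) w))
      (measurable_kernelTerm _ _).aemeasurable).trans (by norm_num)
  calc _ ≤ (m : ℝ) * ((1 / (m : ℝ)) ^ 2 * 1) := by gcongr
    _ = 1 / (m : ℝ) := by field_simp

theorem measurable_ntkMatrix_apply (i j : Fin n) :
    Measurable fun W : Fin m → EuclideanSpace ℝ (Fin p) => ntkMatrix x W i j := by
  simp only [ntkMatrix_apply]
  exact Finset.measurable_sum _ fun r _ =>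
    ((measurable_kernelTerm _ _).comp (measurable_pi_apply r)).const_mul _

theorem measurable_kernel_deviation (x : Fin n → EuclideanSpace ℝ (Fin p)) :
    Measurable fun W : Fin m → EuclideanSpace ℝ (Fin p) =>
      ∑ i, ∑ j, (ntkMatrix x W i j - limitNTK x i j) ^ 2 :=
  Finset.measurable_sum _ fun i _ => Finset.measurable_sum _ fun j _ =>
    ((measurable_ntkMatrix_apply i j).sub_const _).pow_const 2

/-- The finite-width kernel is close to its limit. -/
theorem measure_kernel_deviation_le (hm : 0 < m) (hx : ∀ i, ‖x i‖ = 1) {θ η : ℝ} (hθ : 0 < θ)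
    (h : (n : ℝ) ^ 2 / m ≤ η * θ) :
    initLaw m p {ω | θ ≤ ∑ i, ∑ j, (ntkMatrix x ω.1 i j - limitNTK x i j) ^ 2} ≤
      ENNReal.ofReal η := by
  have hmeas := measurable_kernel_deviation (m := m) x
  refine (initLaw_fst_preimage (measurableSet_le measurable_const hmeas)).trans_le
    (measure_ge_le_of_lintegral_le hmeas hθ h ?_)
  have hrw : ∀ W : Fin m → EuclideanSpace ℝ (Fin p),
      ENNReal.ofReal (∑ i, ∑ j, (ntkMatrix x W i j - limitNTK x i j) ^ 2) =
      ∑ i, ∑ j, ENNReal.ofReal ((ntkMatrix x W i j - limitNTK x i j) ^ 2) := by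
    intro W
    rw [ENNReal.ofReal_sum_of_nonneg fun i _ => Finset.sum_nonneg fun j _ => sq_nonneg _]
    exact Finset.sum_congr rfl fun i _ => ENNReal.ofReal_sum_of_nonneg fun j _ => sq_nonneg _
  have hmij : ∀ i j, Measurable fun W : Fin m → EuclideanSpace ℝ (Fin p) =>
      ENNReal.ofReal ((ntkMatrix x W i j - limitNTK x i j) ^ 2) := fun i j =>
    (((measurable_ntkMatrix_apply i j).sub_const _).pow_const 2).ennreal_ofReal
  simp only [hrw]
  rw [lintegral_finsetSum _ fun i _ => Finset.measurable_sum _ fun j _ => hmij i j]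
  calc _ ≤ ∑ _i : Fin n, ∑ _j : Fin n, ENNReal.ofReal (1 / m) := by
        refine Finset.sum_le_sum fun i _ => ?_
        rw [lintegral_finsetSum _ fun j _ => hmij i j]
        exact Finset.sum_le_sum fun j _ => lintegral_sq_ntkMatrix_sub_le hm hx i j
    _ = ENNReal.ofReal ((n : ℝ) ^ 2 / m) := by
        simp only [Finset.sum_const, Finset.card_univ, Fintype.card_fin, nsmul_eq_mul]
        rw [← ENNReal.ofReal_natCast, ← ENNReal.ofReal_mul (by positivity),
          ← ENNReal.ofReal_mul (by positivity)]
        congr 1; ring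

theorem measurable_flipFraction (x : Fin n → EuclideanSpace ℝ (Fin p)) (R : ℝ) :
    Measurable fun W : Fin m → EuclideanSpace ℝ (Fin p) => flipFraction x R W :=
  (Finset.measurable_sum _ fun _ _ => Finset.measurable_sum _ fun _ _ =>
    Measurable.ite (measurableSet_le (by fun_prop) measurable_const) measurable_const
      measurable_const).const_mul _

/-- Few neurons are initialized close to a kink. -/
theorem measure_flipFraction_ge_le (hm : 0 < m) (hx : ∀ i, ‖x i‖ = 1) {R θ η : ℝ}
    (hθ : 0 < θ) (h : n * R ≤ η * θ) :
    initLaw m p {ω | θ ≤ flipFraction x R ω.1} ≤ ENNReal.ofReal η := by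
  classical
  have hm' : (0 : ℝ) < m := Nat.cast_pos.2 hm
  have hset : ∀ i, MeasurableSet {w : EuclideanSpace ℝ (Fin p) | |inner ℝ w (x i)| ≤ R} :=
    fun i => measurableSet_le (by fun_prop) measurable_const
  have hterm : ∀ i r, Measurable fun W : Fin m → EuclideanSpace ℝ (Fin p) =>
      if |inner ℝ (W r) (x i)| ≤ R then (1 : ℝ) else 0 := fun i r =>
    Measurable.ite (measurableSet_le (by fun_prop) measurable_const) measurable_const
      measurable_const
  have hmeas := measurable_flipFraction (m := m) x R
  refine (initLaw_fst_preimage (measurableSet_le measurable_const hmeas)).trans_le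
    (measure_ge_le_of_lintegral_le hmeas hθ h ?_)
  have hnn : ∀ (i : Fin n) (W : Fin m → EuclideanSpace ℝ (Fin p)) (r : Fin m),
      (0 : ℝ) ≤ if |inner ℝ (W r) (x i)| ≤ R then (1 : ℝ) else 0 := fun i W r => by
    split_ifs <;> norm_num
  have hrw : ∀ W : Fin m → EuclideanSpace ℝ (Fin p),
      ENNReal.ofReal (flipFraction x R W) = ENNReal.ofReal (1 / m) *
      ∑ i, ∑ r, ENNReal.ofReal (if |inner ℝ (W r) (x i)| ≤ R then (1 : ℝ) else 0) := by
    intro W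
    rw [flipFraction, ENNReal.ofReal_mul (by positivity),
      ENNReal.ofReal_sum_of_nonneg fun i _ => Finset.sum_nonneg fun r _ => by
        convert hnn i W r]
    congr 1
    refine Finset.sum_congr rfl fun i _ => ?_
    rw [ENNReal.ofReal_sum_of_nonneg fun r _ => by convert hnn i W r]
  have hprob : ∀ i r, ∫⁻ W, ENNReal.ofReal (if |inner ℝ (W r) (x i)| ≤ R then (1 : ℝ) else 0)
      ∂(Measure.pi fun _ : Fin m => stdGaussian (EuclideanSpace ℝ (Fin p))) ≤
      ENNReal.ofReal R := by
    intro i r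
    have h1 : ∀ W : Fin m → EuclideanSpace ℝ (Fin p),
        ENNReal.ofReal (if |inner ℝ (W r) (x i)| ≤ R then (1 : ℝ) else 0) =
        ((fun W : Fin m → EuclideanSpace ℝ (Fin p) => W r) ⁻¹'
          {w | |inner ℝ w (x i)| ≤ R}).indicator 1 W := by
      intro W
      by_cases hW : |inner ℝ (W r) (x i)| ≤ R <;> simp [hW]
    simp only [h1]
    rw [lintegral_indicator_one (measurable_pi_apply r (hset i)),
      (measurePreserving_eval (fun _ : Fin m => stdGaussian (EuclideanSpace ℝ (Fin p)))
        r).measure_preimage (hset i).nullMeasurableSet]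
    refine le_trans (le_of_eq ?_) (gaussianReal_Icc_le R)
    rw [← map_inner_stdGaussian (hx i), Measure.map_apply (by fun_prop) measurableSet_Icc]
    congr 1
    ext w
    simp [abs_le]
  simp only [hrw]
  rw [lintegral_const_mul _ (Finset.measurable_sum _ fun i _ => Finset.measurable_sum _ fun r _ =>
    (hterm i r).ennreal_ofReal), lintegral_finsetSum _ fun i _ => Finset.measurable_sum _
      fun r _ => (hterm i r).ennreal_ofReal]
  calc _ ≤ ENNReal.ofReal (1 / m) * ∑ _i : Fin n, ∑ _r : Fin m, ENNReal.ofReal R := by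
        gcongr with i
        rw [lintegral_finsetSum _ fun r _ => (hterm i r).ennreal_ofReal]
        exact Finset.sum_le_sum fun r _ => hprob i r
    _ = ENNReal.ofReal (n * R) := by
        simp only [Finset.sum_const, Finset.card_univ, Fintype.card_fin, nsmul_eq_mul]
        rw [← ENNReal.ofReal_natCast, ← ENNReal.ofReal_natCast,
          ← ENNReal.ofReal_mul (by positivity), ← ENNReal.ofReal_mul (by positivity),
          ← ENNReal.ofReal_mul (by positivity)]
        congr 1; field_simp

theorem measurable_network (u : EuclideanSpace ℝ (Fin p)) :
    Measurable fun ω : (Fin m → EuclideanSpace ℝ (Fin p)) × (Fin m → ℝ) =>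
      network ω.1 ω.2 u := by
  have := lipschitzWith_relu.continuous.measurable
  unfold network
  fun_prop

/-- The outputs of the network have second moment at most `1` at initialization. -/
theorem lintegral_sq_network_le (hm : 0 < m) {u : EuclideanSpace ℝ (Fin p)} (hu : ‖u‖ = 1) :
    ∫⁻ ω, ENNReal.ofReal (network ω.1 ω.2 u ^ 2) ∂(initLaw m p) ≤ 1 := by
  have hm' : (0 : ℝ) < m := Nat.cast_pos.2 hm
  rw [initLaw, lintegral_prod _ ((measurable_network u).pow_const 2).ennreal_ofReal.aemeasurable]
  -- For fixed W the independent centred signs kill the cross terms; the Gaussian weights are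
  -- integrated afterwards.
  have hinner : ∀ W : Fin m → EuclideanSpace ℝ (Fin p),
      ∫⁻ a, ENNReal.ofReal (network W a u ^ 2) ∂(Measure.pi fun _ : Fin m => signMeasure) ≤
      ∑ r, ENNReal.ofReal (1 / m) * ENNReal.ofReal (inner ℝ (W r) u ^ 2) := by
    intro W
    have h := lintegral_sq_sum_sub_pi (ι := Fin m) (μ := signMeasure)
      (X := fun r z => 1 / Real.sqrt m * relu (inner ℝ (W r) u) * z)
      fun r => memLp_id_signMeasure.const_mul _
    have hI : ∀ c : ℝ, ∫ z, c * z ∂signMeasure = 0 := fun c => by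
      rw [integral_const_mul, integral_id_signMeasure, mul_zero]
    have hV : ∀ c : ℝ, Var[fun z => c * z; signMeasure] = c ^ 2 := fun c => by
      rw [variance_const_mul, variance_id_signMeasure, mul_one]
    simp only [hI, hV, Finset.sum_const_zero, sub_zero] at h
    have h1 : ∀ a : Fin m → ℝ, network W a u =
        ∑ r, 1 / Real.sqrt m * relu (inner ℝ (W r) u) * a r := by
      intro a
      rw [network, Finset.mul_sum]
      exact Finset.sum_congr rfl fun r _ => by ring
    simp only [h1]
    rw [h, ENNReal.ofReal_sum_of_nonneg fun r _ => sq_nonneg _]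
    refine Finset.sum_le_sum fun r _ => ?_
    rw [← ENNReal.ofReal_mul (by positivity)]
    refine ENNReal.ofReal_le_ofReal ?_
    rw [mul_pow, div_pow, Real.sq_sqrt hm'.le, one_pow]
    refine mul_le_mul_of_nonneg_left ?_ (by positivity)
    rw [← sq_abs (inner ℝ (W r) u)]
    refine pow_le_pow_left₀ (relu_nonneg _) ?_ 2
    exact max_le (le_abs_self _) (abs_nonneg _)
  refine (lintegral_mono hinner).trans ?_
  rw [lintegral_finsetSum _ fun r _ => by fun_prop]
  have hr : ∀ r : Fin m, ∫⁻ W : Fin m → EuclideanSpace ℝ (Fin p),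
      ENNReal.ofReal (1 / m) * ENNReal.ofReal (inner ℝ (W r) u ^ 2)
      ∂(Measure.pi fun _ : Fin m => stdGaussian (EuclideanSpace ℝ (Fin p))) =
      ENNReal.ofReal (1 / m) := by
    intro r
    rw [lintegral_const_mul _ (by fun_prop),
      (measurePreserving_eval (fun _ : Fin m => stdGaussian (EuclideanSpace ℝ (Fin p)))
        r).lintegral_comp (f := fun w => ENNReal.ofReal (inner ℝ w u ^ 2)) (by fun_prop),
      lintegral_sq_inner_stdGaussian hu, mul_one]
  simp only [hr, Finset.sum_const, Finset.card_univ, Fintype.card_fin, nsmul_eq_mul]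
  rw [← ENNReal.ofReal_natCast, ← ENNReal.ofReal_mul (by positivity)]
  simp [hm'.ne']

theorem measurable_norm_sq_errorVec (x : Fin n → EuclideanSpace ℝ (Fin p)) (y : Fin n → ℝ) :
    Measurable fun ω : (Fin m → EuclideanSpace ℝ (Fin p)) × (Fin m → ℝ) =>
      ‖errorVec x y ω.2 ω.1‖ ^ 2 := by
  simp only [EuclideanSpace.real_norm_sq_eq]
  exact Finset.measurable_sum _ fun i _ => ((measurable_network (x i)).sub_const (y i)).pow_const 2

/-- The initial error is not too large. -/
theorem measure_norm_sq_errorVec_ge_le (hm : 0 < m) (hx : ∀ i, ‖x i‖ = 1) {y : Fin n → ℝ} {B : ℝ}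
    (hy : ∀ i, |y i| < B) {θ η : ℝ} (hθ : 0 < θ) (h : n * (2 * (1 + B ^ 2)) ≤ η * θ) :
    initLaw m p {ω | θ ≤ ‖errorVec x y ω.2 ω.1‖ ^ 2} ≤ ENNReal.ofReal η := by
  refine measure_ge_le_of_lintegral_le (measurable_norm_sq_errorVec x y) hθ h ?_
  have hpt : ∀ ω : (Fin m → EuclideanSpace ℝ (Fin p)) × (Fin m → ℝ),
      ENNReal.ofReal (‖errorVec x y ω.2 ω.1‖ ^ 2) ≤
      ∑ i, (ENNReal.ofReal 2 * ENNReal.ofReal (network ω.1 ω.2 (x i) ^ 2) +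
        ENNReal.ofReal (2 * B ^ 2)) := by
    intro ω
    rw [EuclideanSpace.real_norm_sq_eq, ENNReal.ofReal_sum_of_nonneg fun i _ => sq_nonneg _]
    refine Finset.sum_le_sum fun i _ => ?_
    rw [← ENNReal.ofReal_mul (by norm_num), ← ENNReal.ofReal_add (by positivity) (by positivity)]
    refine ENNReal.ofReal_le_ofReal ?_
    have h1 : y i ^ 2 ≤ B ^ 2 := sq_le_sq' (by linarith [(abs_lt.1 (hy i)).1]) (abs_lt.1 (hy i)).2.le
    change (network ω.1 ω.2 (x i) - y i) ^ 2 ≤ _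
    nlinarith [sq_nonneg (network ω.1 ω.2 (x i) + y i)]
  refine (lintegral_mono hpt).trans ?_
  have hmi : ∀ i, Measurable fun ω : (Fin m → EuclideanSpace ℝ (Fin p)) × (Fin m → ℝ) =>
      ENNReal.ofReal (network ω.1 ω.2 (x i) ^ 2) := fun i =>
    ((measurable_network (x i)).pow_const 2).ennreal_ofReal
  rw [lintegral_finsetSum _ fun i _ => ((hmi i).const_mul _).add_const _]
  calc _ ≤ ∑ _i : Fin n, (ENNReal.ofReal 2 * 1 + ENNReal.ofReal (2 * B ^ 2)) := by
        refine Finset.sum_le_sum fun i _ => ?_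
        rw [lintegral_add_right _ measurable_const, lintegral_const_mul _ (hmi i), lintegral_const,
          measure_univ, mul_one]
        gcongr
        exact lintegral_sq_network_le hm (hx i)
    _ = ENNReal.ofReal (n * (2 * (1 + B ^ 2))) := by
        simp only [Finset.sum_const, Finset.card_univ, Fintype.card_fin, nsmul_eq_mul, mul_one]
        rw [← ENNReal.ofReal_natCast, ← ENNReal.ofReal_add (by norm_num) (by positivity),
          ← ENNReal.ofReal_mul (by positivity)]
        congr 1; ring

end Initialization

/-! ### Good initializations and the choice of constants -/

variable {m n p : ℕ} {x : Fin n → EuclideanSpace ℝ (Fin p)} {y : Fin n → ℝ}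

/-- The initializations from which the heavy ball flow is shown to converge: the error is at most
`θ₁`, at most a fraction `θ₂` of the activations is within `R` of a kink, and the kernel is within
`θ₃` of its limit. -/
def goodInit (m : ℕ) (x : Fin n → EuclideanSpace ℝ (Fin p)) (y : Fin n → ℝ) (R θ₁ θ₂ θ₃ : ℝ) :
    Set ((Fin m → EuclideanSpace ℝ (Fin p)) × (Fin m → ℝ)) :=
  {ω | (∀ r, ω.2 r ^ 2 = 1) ∧ ‖errorVec x y ω.2 ω.1‖ ^ 2 < θ₁ ∧ flipFraction x R ω.1 < θ₂ ∧
    ∑ i, ∑ j, (ntkMatrix x ω.1 i j - limitNTK x i j) ^ 2 < θ₃}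

theorem measurableSet_goodInit (R θ₁ θ₂ θ₃ : ℝ) :
    MeasurableSet (goodInit m x y R θ₁ θ₂ θ₃) := by
  refine MeasurableSet.inter ?_ (MeasurableSet.inter ?_ (MeasurableSet.inter ?_ ?_))
  · have : {ω : (Fin m → EuclideanSpace ℝ (Fin p)) × (Fin m → ℝ) | ∀ r, ω.2 r ^ 2 = 1} =
        ⋂ r, {ω | ω.2 r ^ 2 = 1} := by ext; simp
    change MeasurableSet {ω : (Fin m → EuclideanSpace ℝ (Fin p)) × (Fin m → ℝ) |
      ∀ r, ω.2 r ^ 2 = 1}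
    rw [this]
    exact MeasurableSet.iInter fun r => measurableSet_eq_fun (by fun_prop) measurable_const
  · exact measurableSet_lt (measurable_norm_sq_errorVec x y) measurable_const
  · exact measurableSet_lt ((measurable_flipFraction x R).comp measurable_fst) measurable_const
  · exact measurableSet_lt ((measurable_kernel_deviation x).comp measurable_fst) measurable_const

/-- A union bound: each of the three Markov events costs δ/3, and a sign with aᵣ² ≠ 1 has
probability zero. -/
theorem le_initLaw_goodInit (hm : 0 < m) (hx : ∀ i, ‖x i‖ = 1) {B : ℝ} (hy : ∀ i, |y i| < B)
    {R θ₁ θ₂ θ₃ δ : ℝ} (hδ : 0 < δ) (hθ₁ : 0 < θ₁) (hθ₂ : 0 < θ₂) (hθ₃ : 0 < θ₃)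
    (h₁ : n * (2 * (1 + B ^ 2)) ≤ δ / 3 * θ₁) (h₂ : n * R ≤ δ / 3 * θ₂)
    (h₃ : (n : ℝ) ^ 2 / m ≤ δ / 3 * θ₃) :
    ENNReal.ofReal (1 - δ) ≤ initLaw m p (goodInit m x y R θ₁ θ₂ θ₃) := by
  have hcompl : initLaw m p (goodInit m x y R θ₁ θ₂ θ₃)ᶜ ≤ ENNReal.ofReal δ := by
    have hsub : (goodInit m x y R θ₁ θ₂ θ₃)ᶜ ⊆ {ω | ¬ ∀ r, ω.2 r ^ 2 = 1} ∪
        ({ω | θ₁ ≤ ‖errorVec x y ω.2 ω.1‖ ^ 2} ∪ ({ω | θ₂ ≤ flipFraction x R ω.1} ∪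
          {ω | θ₃ ≤ ∑ i, ∑ j, (ntkMatrix x ω.1 i j - limitNTK x i j) ^ 2})) := by
      intro ω hω
      by_contra hcon
      simp only [Set.mem_union, Set.mem_ofPred_eq, not_or, not_le, not_not] at hcon
      exact hω hcon
    calc _ ≤ _ := measure_mono hsub
      _ ≤ 0 + (ENNReal.ofReal (δ / 3) + (ENNReal.ofReal (δ / 3) + ENNReal.ofReal (δ / 3))) := by
          refine (measure_union_le _ _).trans (add_le_add (le_of_eq ae_sq_eq_one_initLaw) ?_)
          refine (measure_union_le _ _).trans
            (add_le_add (measure_norm_sq_errorVec_ge_le hm hx hy hθ₁ h₁) ?_)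
          exact (measure_union_le _ _).trans (add_le_add (measure_flipFraction_ge_le hm hx hθ₂ h₂)
            (measure_kernel_deviation_le hm hx hθ₃ h₃))
      _ = ENNReal.ofReal δ := by
          rw [zero_add, ← ENNReal.ofReal_add (by positivity) (by positivity),
            ← ENNReal.ofReal_add (by positivity) (by positivity)]
          congr 1; ring
  rw [ENNReal.ofReal_sub _ hδ.le, ENNReal.ofReal_one, tsub_le_iff_right,
    ← prob_add_prob_compl (μ := initLaw m p) (measurableSet_goodInit (x := x) (y := y) R θ₁ θ₂ θ₃)]
  gcongr

/-- Convergence from a good initialization. -/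
theorem loss_le_of_mem_goodInit {ρ R θ₁ : ℝ} (hρ : 0 < ρ) (hx : ∀ i, ‖x i‖ = 1)
    (hlam : lambdaMin (limitNTK x) = 2 * ρ ^ 2)
    (hR0 : 0 ≤ R) (hR : (8 / (3 * ρ ^ 2)) ^ 2 * (n / m * θ₁) ≤ R ^ 2)
    (hnm : 0 < (n : ℝ) / m)
    {W₀ : Fin m → EuclideanSpace ℝ (Fin p)} {a : Fin m → ℝ}
    (hG : (W₀, a) ∈ goodInit m x y R θ₁ ((ρ / 6) ^ 2) ((ρ ^ 2 / 5) ^ 2))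
    {W : ℝ → Fin m → EuclideanSpace ℝ (Fin p)} (hW0 : W 0 = W₀)
    (hflow : IsHeavyBallFlow (2 * ρ) x y a W) {t : ℝ} (ht : 0 ≤ t) :
    loss x y (W t) a ≤ 4 / (2 * ρ ^ 2) * Real.exp (-(ρ * t)) * pseudoLoss x y W₀ a := by
  obtain ⟨ha, herr, hflip, hker⟩ := hG
  -- The limit contributes 2ρ² = λ₀ and the Frobenius error removes at most ρ²/5.
  have hH : ∀ z : Fin n → ℝ, 9 / 5 * ρ ^ 2 * ∑ i, z i ^ 2 ≤ z ⬝ᵥ (ntkMatrix x W₀).mulVec z := by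
    intro z
    have h1 := lambdaMin_mul_sum_sq_le (isHermitian_limitNTK x) z
    have h2 := dotProduct_mulVec_ge_sub (by positivity) hker.le z
    rw [hlam] at h1
    linarith
  have hdisp : 8 / (3 * ρ ^ 2) * (Real.sqrt n / Real.sqrt m * ‖errorVec x y a W₀‖) < R := by
    refine lt_of_pow_lt_pow_left₀ 2 hR0 (lt_of_lt_of_le ?_ hR)
    rw [mul_pow, mul_pow, div_pow (Real.sqrt n), Real.sq_sqrt (Nat.cast_nonneg n),
      Real.sq_sqrt (Nat.cast_nonneg m)]
    gcongr
  have hmain := norm_sq_errorVec_le_of_isHeavyBallFlow hρ hx ha hH hflip.le hdisp hW0 hflow ht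
  have h0 : 9 / 5 * ρ ^ 2 * ‖errorVec x y a W₀‖ ^ 2 ≤ 2 * pseudoLoss x y W₀ a := by
    have := hH (predError x y W₀ a)
    rw [EuclideanSpace.real_norm_sq_eq, pseudoLoss]
    refine this.trans (le_of_eq ?_)
    ring
  have hL : ‖errorVec x y a W₀‖ ^ 2 ≤ 10 / 9 * pseudoLoss x y W₀ a / ρ ^ 2 := by
    rw [le_div_iff₀ (by positivity)]
    linarith
  have hP : 0 ≤ pseudoLoss x y W₀ a / ρ ^ 2 := by
    have : 0 ≤ 10 / 9 * pseudoLoss x y W₀ a / ρ ^ 2 := (sq_nonneg _).trans hL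
    rw [mul_div_assoc] at this
    linarith
  rw [loss_eq_norm_sq_errorVec]
  have hE := Real.exp_pos (-(ρ * t))
  calc 1 / 2 * ‖errorVec x y a (W t)‖ ^ 2
      ≤ 1 / 2 * (16 / 7 * Real.exp (-(ρ * t)) * (10 / 9 * pseudoLoss x y W₀ a / ρ ^ 2)) := by
        refine mul_le_mul_of_nonneg_left (hmain.trans ?_) (by norm_num)
        exact mul_le_mul_of_nonneg_left hL (by positivity)
    _ = 80 / 63 * (Real.exp (-(ρ * t)) * (pseudoLoss x y W₀ a / ρ ^ 2)) := by ring
    -- The constant 80/63 = ½ · 16/7 · 10/9 fits within the claimed 4/λ₀ = 2/ρ².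
    _ ≤ 2 * (Real.exp (-(ρ * t)) * (pseudoLoss x y W₀ a / ρ ^ 2)) := by
        refine mul_le_mul_of_nonneg_right (by norm_num) (mul_nonneg hE.le hP)
    _ = _ := by field_simp; ring

end HeavyBallNTK

theorem mainTheorem1 (B : ℝ) :
    ∃ C : ℝ, 0 < C ∧
      ∀ (n p m : ℕ) (x : Fin n → EuclideanSpace ℝ (Fin p)) (y : Fin n → ℝ) (lam0 δ : ℝ),
        0 < n →
        (∀ i, ‖x i‖ = 1) →
        (∀ i, |y i| < B) →
        lam0 = HeavyBallNTK.lambdaMin (HeavyBallNTK.limitNTK x) →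
        0 < lam0 →
        0 < δ → δ < 1 →
        C * ((n : ℝ) ^ 6 / (δ ^ 3 * lam0 ^ 4)) ≤ (m : ℝ) →
        ∃ G : Set ((Fin m → EuclideanSpace ℝ (Fin p)) × (Fin m → ℝ)),
          MeasurableSet G ∧
          ENNReal.ofReal (1 - δ) ≤ HeavyBallNTK.initLaw m p G ∧
          ∀ (W₀ : Fin m → EuclideanSpace ℝ (Fin p)) (a : Fin m → ℝ), (W₀, a) ∈ G →
            ∀ W : ℝ → Fin m → EuclideanSpace ℝ (Fin p),
              W 0 = W₀ →
              HeavyBallNTK.IsHeavyBallFlow (Real.sqrt (2 * lam0)) x y a W →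
              ∀ t : ℝ, 0 ≤ t →
                HeavyBallNTK.loss x y (W t) a ≤
                  4 / lam0 * Real.exp (-(Real.sqrt (lam0 / 2) * t)) *
                    HeavyBallNTK.pseudoLoss x y W₀ a := by
  -- The displacement condition is the demanding one: it needs (512/3) · 46656 ≈ 7.97 · 10⁶, with
  -- 46656 = 216².
  refine ⟨10 ^ 7 * (1 + B ^ 2), by positivity, ?_⟩
  intro n p m x y lam0 δ hn hx hy hlam hlam0 hδ hδ1 hm
  have hlam1 : lam0 ≤ 1 := hlam ▸ HeavyBallNTK.lambdaMin_limitNTK_le_one hn hx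
  have hn1 : (1 : ℝ) ≤ n := by exact_mod_cast hn
  have hmpos : (0 : ℝ) < m := lt_of_lt_of_le (by positivity) hm
  have hmpos' : 0 < m := by exact_mod_cast hmpos
  have hmul : 10 ^ 7 * (1 + B ^ 2) * (n : ℝ) ^ 6 ≤ m * (δ ^ 3 * lam0 ^ 4) := by
    rwa [← mul_div_assoc, div_le_iff₀ (by positivity)] at hm
  set ρ := Real.sqrt (lam0 / 2) with hρdef
  have hρ : 0 < ρ := Real.sqrt_pos.2 (by positivity)
  have hρ2 : ρ ^ 2 = lam0 / 2 := Real.sq_sqrt (by positivity)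
  have hb : Real.sqrt (2 * lam0) = 2 * ρ := by
    rw [show 2 * lam0 = (2 * ρ) ^ 2 by rw [mul_pow, hρ2]; ring]
    exact Real.sqrt_sq (by positivity)
  -- R and θ₁ are chosen so that the Markov bounds for the flips and for the error equal δ/3
  -- exactly.
  set R := lam0 * δ / (216 * n) with hRdef
  set θ₁ := 6 * n * (1 + B ^ 2) / δ with hθ₁def
  refine ⟨HeavyBallNTK.goodInit m x y R θ₁ ((ρ / 6) ^ 2) ((ρ ^ 2 / 5) ^ 2),
    HeavyBallNTK.measurableSet_goodInit _ _ _ _,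
    HeavyBallNTK.le_initLaw_goodInit hmpos' hx hy hδ (by positivity) (by positivity)
      (by positivity) ?_ ?_ ?_, ?_⟩
  · rw [hθ₁def]
    refine le_of_eq ?_
    field_simp
    ring
  · rw [hRdef, div_pow, hρ2]
    refine le_of_eq ?_
    field_simp
    ring
  -- Kernel concentration only needs m ≥ 300 n²/(δλ₀²); the surplus powers are discarded using n ≥
  -- 1, δ < 1 and λ₀ ≤ 1.
  · rw [hρ2, div_le_iff₀ hmpos]
    have h1 : (n : ℝ) ^ 2 ≤ n ^ 6 := pow_le_pow_right₀ hn1 (by norm_num)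
    have h2 : δ ^ 3 * lam0 ^ 4 ≤ δ * lam0 ^ 2 :=
      mul_le_mul (pow_le_of_le_one hδ.le hδ1.le (by norm_num))
        (pow_le_pow_of_le_one hlam0.le hlam1 (by norm_num)) (by positivity) hδ.le
    have h3 := mul_le_mul_of_nonneg_left h2 hmpos.le
    have h4 : (n : ℝ) ^ 6 ≤ (1 + B ^ 2) * n ^ 6 :=
      le_mul_of_one_le_left (by positivity) (by nlinarith [sq_nonneg B])
    have h5 : δ / 3 * (lam0 / 2 / 5) ^ 2 * m = m * (δ * lam0 ^ 2) / 300 := by ring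
    rw [h5, le_div_iff₀ (by norm_num)]
    have h6 : (0 : ℝ) ≤ n ^ 6 := by positivity
    linarith
  · intro W₀ a hG W hW0 hflow t ht
    rw [hb] at hflow
    have hlam2 : lam0 = 2 * ρ ^ 2 := by rw [hρ2]; ring
    have h := HeavyBallNTK.loss_le_of_mem_goodInit hρ hx (by rw [← hlam, ← hlam2])
      (by positivity) ?_ (by positivity) hG hW0 hflow ht
    · rwa [← hlam2] at h
    · rw [hρ2, hRdef, hθ₁def]
      -- Keeping the displacement below R asks for m of order n⁴/(δ³λ₀⁴), so n⁶ leaves room.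
      have h1 : (n : ℝ) ^ 4 ≤ n ^ 6 := pow_le_pow_right₀ hn1 (by norm_num)
      have h2 : 10 ^ 7 * ((1 + B ^ 2) * (n : ℝ) ^ 4) ≤ m * (δ ^ 3 * lam0 ^ 4) := by
        have := mul_le_mul_of_nonneg_left h1 (by positivity : 0 ≤ 1 + B ^ 2)
        linarith
      have e1 : (8 / (3 * (lam0 / 2))) ^ 2 * (n / m * (6 * n * (1 + B ^ 2) / δ)) =
          512 / 3 * ((1 + B ^ 2) * (n : ℝ) ^ 4) / (m * δ * lam0 ^ 2 * n ^ 2) := by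
        field_simp; ring
      have e2 : (lam0 * δ / (216 * n)) ^ 2 =
          m * (δ ^ 3 * lam0 ^ 4) / 46656 / (m * δ * lam0 ^ 2 * n ^ 2) := by
        field_simp; ring
      rw [e1, e2]
      gcongr
      have h3 : 0 ≤ (1 + B ^ 2) * (n : ℝ) ^ 4 := by positivity
      linarith
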